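/- Let $k$ be a field of arbitrary characteristic. Let $A=\bigoplus_{i\in\mathbb Z}A^i$ be a differential graded $k$-algebra, i.e. a $\mathbb Z$-graded associative unital $k$-algebra with a $k$-linear differential $d$ of degree $+1$ satisfying $d^2=0$ and $d(ab)=d(a)b+(-1)^n a\,d(b)$ for $a\in A^n$, $b\in A$. Assume that $A$ is simply connected of finite type, i.e. $A^i=0$ for all $i<0$, $\dim_k H^*A<\infty$, $H^0A\cong k$ and $H^1A=0$. Let $\varepsilon\colon A\to k$ be an augmentation, i.e. a morphism of differential graded $k$-algebras to $k$ (concentrated in degree $0$, with zero differential), and let $k_A$ be the differential graded right $A$-module $k$, concentrated in degree $0$, on which $A$ acts through $\varepsilon$. Let $\mathbf D(A)$ be the derived category of differential graded right $A$-modules, i.e. the localisation at the quasi-isomorphisms of the homotopy category of differential graded right $A$-modules. If $\dim_k H^*A\ge 2$, then $k_A$ is not a compact object of $\mathbf D(A)$. Here an object $X$ is compact if for every (set-indexed) family $(X_\alpha)$ of objects every morphism $X\to\coprod_\alpha X_\alpha$ factors through the coproduct of a finite subfamily; equivalently, if $\operatorname{Hom}_{\mathbf D(A)}(X,-)$ preserves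 coproducts. -/

import Mathlib

open CategoryTheory Limits

universe w v u

noncomputable section

namespace DG

/-! ### Cohomology of a graded vector space with a differential -/

section Cohomology

variable {k V : Type u} [Field k] [AddCommGroup V] [Module k V]

/-- `Zⁿ`: the elements of degree `n` killed by the differential. -/
def cocycles (gr : ℤ → Submodule k V) (d : V →ₗ[k] V) (n : ℤ) : Submodule k V :=
  gr n ⊓ LinearMap.ker d

/-- `Bⁿ`: the image under the differential of the elements of degree `n - 1`. -/
def coboundaries (gr : ℤ → Submodule k V) (d : V →ₗ[k] V) (n : ℤ) : Submodule k V :=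
  (gr (n - 1)).map d

/-- `Hⁿ = Zⁿ / Bⁿ`. -/
abbrev Cohomology (gr : ℤ → Submodule k V) (d : V →ₗ[k] V) (n : ℤ) : Type u :=
  cocycles gr d n ⧸ (coboundaries gr d n).submoduleOf (cocycles gr d n)

end Cohomology

/-! ### Differential graded algebras -/

/-- A differential graded `k`-algebra: a `ℤ`-graded (associative, unital) `k`-algebra with a
`k`-linear differential of degree `+1` satisfying the graded Leibniz rule. -/
structure DGAlgebra (k : Type u) [Field k] where
  carrier : Type u
  [ring : Ring carrier]
  [algebra : Algebra k carrier]
  /-- the homogeneous components -/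
  gr : ℤ → Submodule k carrier
  [graded : GradedAlgebra gr]
  d : carrier →ₗ[k] carrier
  d_mem : ∀ (n : ℤ) (a : carrier), a ∈ gr n → d a ∈ gr (n + 1)
  d_d : ∀ a : carrier, d (d a) = 0
  leibniz : ∀ (n : ℤ) (a b : carrier), a ∈ gr n →
    d (a * b) = d a * b + n.negOnePow • (a * d b)

attribute [instance] DGAlgebra.ring DGAlgebra.algebra DGAlgebra.graded

namespace DGAlgebra

variable {k : Type u} [Field k] (A : DGAlgebra k)

/-- `Hⁿ A`. -/
abbrev H (n : ℤ) : Type u := Cohomology A.gr A.d n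

/-- `H* A`, the direct sum of all `Hⁿ A`, as a `k`-vector space. -/
abbrev TotalH : Type u := DirectSum ℤ fun n => A.H n

/-- Simply connected of finite type: `A` is positively graded (zero in negative degrees),
`H* A` is finite dimensional, `H⁰ A ≅ k` and `H¹ A = 0`. -/
structure IsSimplyConnectedOfFiniteType : Prop where
  positively_graded : ∀ n : ℤ, n < 0 → A.gr n = ⊥
  finite : Module.Finite k A.TotalH
  H_zero : Nonempty (A.H 0 ≃ₗ[k] k)
  H_one : Subsingleton (A.H 1)

/-- An augmentation: a morphism of differential graded algebras from `A` to the field `k`,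
regarded as a differential graded algebra concentrated in degree `0` with zero differential.
As a morphism of `k`-algebras it splits the structure morphism `k → A`. -/
structure Augmentation where
  toAlgHom : A.carrier →ₐ[k] k
  map_of_ne_zero : ∀ (n : ℤ) (a : A.carrier), n ≠ 0 → a ∈ A.gr n → toAlgHom a = 0
  map_d : ∀ a : A.carrier, toAlgHom (A.d a) = 0

end DGAlgebra

/-! ### Differential graded modules -/

variable {k : Type u} [Field k]

/-- A differential graded right `A`-module. The right action `x a` is written `x <• a`, that is
`MulOpposite.op a • x`. -/
structure DGModule (A : DGAlgebra k) where
  carrier : Type u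
  [addCommGroup : AddCommGroup carrier]
  [module : Module k carrier]
  [rightModule : Module A.carrierᵐᵒᵖ carrier]
  [isScalarTower : IsScalarTower k A.carrierᵐᵒᵖ carrier]
  /-- the homogeneous components -/
  gr : ℤ → Submodule k carrier
  [decomposition : DirectSum.Decomposition gr]
  act_mem : ∀ (m n : ℤ) (x : carrier) (a : A.carrier),
    x ∈ gr m → a ∈ A.gr n → MulOpposite.op a • x ∈ gr (m + n)
  d : carrier →ₗ[k] carrier
  d_mem : ∀ (n : ℤ) (x : carrier), x ∈ gr n → d x ∈ gr (n + 1)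
  d_d : ∀ x : carrier, d (d x) = 0
  leibniz : ∀ (n : ℤ) (x : carrier) (a : A.carrier), x ∈ gr n →
    d (MulOpposite.op a • x) =
      MulOpposite.op a • d x + n.negOnePow • (MulOpposite.op (A.d a) • x)

attribute [instance] DGModule.addCommGroup DGModule.module DGModule.rightModule
  DGModule.isScalarTower DGModule.decomposition

namespace DGModule

variable {A : DGAlgebra k}

/-- `Hⁿ M`. -/
abbrev H (M : DGModule A) (n : ℤ) : Type u := Cohomology M.gr M.d n

/-- A morphism of differential graded modules: `A`-linear, homogeneous of degree `0` and
commuting with the differentials. -/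
@[ext]
structure Hom (M N : DGModule A) where
  toLinearMap : M.carrier →ₗ[k] N.carrier
  map_act : ∀ (x : M.carrier) (a : A.carrier),
    toLinearMap (MulOpposite.op a • x) = MulOpposite.op a • toLinearMap x
  map_mem : ∀ (n : ℤ) (x : M.carrier), x ∈ M.gr n → toLinearMap x ∈ N.gr n
  map_d : ∀ x : M.carrier, toLinearMap (M.d x) = N.d (toLinearMap x)

/-- The category `C(A)` of differential graded right `A`-modules. -/
instance : Category (DGModule A) where
  Hom := Hom
  id M := ⟨LinearMap.id, fun _ _ => rfl, fun _ _ hx => hx, fun _ => rfl⟩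
  comp f g :=
    { toLinearMap := g.toLinearMap ∘ₗ f.toLinearMap
      map_act := fun x a => by simp [f.map_act, g.map_act]
      map_mem := fun n x hx => g.map_mem n _ (f.map_mem n x hx)
      map_d := fun x => by simp [f.map_d, g.map_d] }

@[simp]
lemma id_toLinearMap (M : DGModule A) : Hom.toLinearMap (𝟙 M) = LinearMap.id := rfl

@[simp]
lemma comp_toLinearMap {M N P : DGModule A} (f : M ⟶ N) (g : N ⟶ P) :
    Hom.toLinearMap (f ≫ g) = g.toLinearMap ∘ₗ f.toLinearMap := rfl

/-- The linear map `Zⁿ M → Zⁿ N` induced by a morphism. -/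
def cocyclesMap {M N : DGModule A} (f : M ⟶ N) (n : ℤ) :
    cocycles M.gr M.d n →ₗ[k] cocycles N.gr N.d n :=
  f.toLinearMap.restrict fun x hx => ⟨f.map_mem n x hx.1, by
    change N.d (f.toLinearMap x) = 0
    rw [← f.map_d, LinearMap.mem_ker.1 hx.2, map_zero]⟩

/-- The linear map `Hⁿ M → Hⁿ N` induced by a morphism. -/
def cohomologyMap {M N : DGModule A} (f : M ⟶ N) (n : ℤ) : M.H n →ₗ[k] N.H n :=
  Submodule.mapQ _ _ (cocyclesMap f n) (by
    rintro ⟨x, hx⟩ ⟨y, hy, hyx⟩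
    exact ⟨f.toLinearMap y, f.map_mem _ y hy, by
      rw [← f.map_d, hyx]; rfl⟩)

/-- The functor `Hⁿ` on `C(A)`. -/
def cohomologyFunctor (A : DGAlgebra k) (n : ℤ) : DGModule A ⥤ ModuleCat.{u} k where
  obj M := ModuleCat.of k (M.H n)
  map f := ModuleCat.ofHom (cohomologyMap f n)
  map_id M := by
    ext x
    rfl
  map_comp f g := by
    ext x
    rfl

/-- Two morphisms `f, g : M ⟶ N` are homotopic if `f - g = d h + h d` for a morphism `h` of degree
`-1` of the underlying graded modules over the underlying graded algebra, that is, if `f - g` is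
null-homotopic. -/
def homotopic (A : DGAlgebra k) : HomRel (DGModule A) := fun M N f g =>
  ∃ h : M.carrier →ₗ[k] N.carrier,
    (∀ (x : M.carrier) (a : A.carrier), h (MulOpposite.op a • x) = MulOpposite.op a • h x) ∧
    (∀ (n : ℤ) (x : M.carrier), x ∈ M.gr n → h x ∈ N.gr (n - 1)) ∧
    ∀ x : M.carrier, f.toLinearMap x - g.toLinearMap x = N.d (h x) + h (M.d x)

lemma cohomologyFunctor_map_eq_of_homotopic (n : ℤ) {M N : DGModule A} (f g : M ⟶ N)
    (hfg : homotopic A f g) :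
    (cohomologyFunctor A n).map f = (cohomologyFunctor A n).map g := by
  obtain ⟨h, -, hdeg, hd⟩ := hfg
  ext x
  induction x using Submodule.Quotient.induction_on with
  | H x =>
    obtain ⟨x, hx⟩ := x
    refine (Submodule.Quotient.eq _).2 ⟨h x, hdeg n x hx.1, ?_⟩
    have := hd x
    rw [LinearMap.mem_ker.1 hx.2, map_zero, add_zero] at this
    exact this.symm

end DGModule

/-! ### The homotopy category and the derived category -/

/-- The homotopy category `H(A)`: the quotient of `C(A)` by the null-homotopic morphisms. -/
abbrev HomotopyCat (A : DGAlgebra k) : Type (u + 1) :=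
  CategoryTheory.Quotient (DGModule.homotopic A)

/-- The functor `Hⁿ` on `H(A)`. -/
def HomotopyCat.cohomologyFunctor (A : DGAlgebra k) (n : ℤ) :
    HomotopyCat A ⥤ ModuleCat.{u} k :=
  CategoryTheory.Quotient.lift _ (DGModule.cohomologyFunctor A n)
    fun _ _ f g hfg => DGModule.cohomologyFunctor_map_eq_of_homotopic n f g hfg

/-- The quasi-isomorphisms in `H(A)`: the morphisms that are isomorphisms in cohomology. -/
def quasiIso (A : DGAlgebra k) : MorphismProperty (HomotopyCat A) := fun _ _ f =>
  ∀ n : ℤ, IsIso ((HomotopyCat.cohomologyFunctor A n).map f)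

/-- The derived category `D(A)`: the localisation of `H(A)` at the quasi-isomorphisms. -/
abbrev DerivedCat (A : DGAlgebra k) : Type (u + 1) :=
  (quasiIso A).Localization

/-- The canonical functor `C(A) ⥤ H(A) ⥤ D(A)`. -/
def toDerivedCat (A : DGAlgebra k) : DGModule A ⥤ DerivedCat A :=
  CategoryTheory.Quotient.functor (DGModule.homotopic A) ⋙ (quasiIso A).Q

/-! ### Compact objects -/

/-- An object `X` is compact (relative to families indexed by types in the universe `w`) if every
morphism from `X` to the coproduct of a family factors through the coproduct of a finite
subfamily. In an additive category with coproducts this says that the natural map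
`∐ Hom(X, Y i) → Hom(X, ∐ Y i)`, which is always injective there, is bijective. -/
def IsCompactObject {C : Type v} [Category.{u} C] (X : C) : Prop :=
  ∀ (ι : Type w) (Y : ι → C) (c : Cofan Y) (_ : IsColimit c) (f : X ⟶ c.pt),
    ∃ (s : Finset ι) (c' : Cofan fun i : s => Y i) (hc' : IsColimit c') (g : X ⟶ c'.pt),
      g ≫ Cofan.IsColimit.desc hc' (fun i : s => c.inj i) = f

/-! ### The module `k_A` -/

section TrivialModule

/-- The grading of `k` concentrated in degree `0`. -/
def trivialGrading (k : Type u) [Field k] (n : ℤ) : Submodule k k :=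
  if n = 0 then ⊤ else ⊥

lemma trivialGrading_eq_zero {n : ℤ} (hn : n ≠ 0) {x : k} (hx : x ∈ trivialGrading k n) :
    x = 0 := by
  simpa [trivialGrading, hn] using hx

instance : DirectSum.Decomposition (trivialGrading k) where
  decompose' x := DirectSum.of (fun n => trivialGrading k n) 0 ⟨x, by simp [trivialGrading]⟩
  left_inv x := by simp
  right_inv x := by
    induction x using DirectSum.induction_on with
    | zero =>
      rw [map_zero]
      exact map_zero (DirectSum.of (fun n => trivialGrading k n) 0)
    | of n y =>
      obtain ⟨y, hy⟩ := y
      by_cases hn : n = 0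
      · subst hn; simp
      · obtain rfl := trivialGrading_eq_zero hn hy
        have h0 : (⟨0, hy⟩ : trivialGrading k n) = 0 := rfl
        rw [h0, map_zero, map_zero]
        exact map_zero (DirectSum.of (fun n => trivialGrading k n) 0)
    | add a b ha hb =>
      refine Eq.trans ?_ (congrArg₂ (· + ·) ha hb)
      rw [← map_add]
      congr 1
      exact map_add _ a b

/-- The differential graded right `A`-module `k_A`: the field `k` in degree `0`, on which `A` acts
through the augmentation. -/
def DGAlgebra.Augmentation.trivialModule {A : DGAlgebra k} (ε : A.Augmentation) : DGModule A :=
  letI : Module A.carrierᵐᵒᵖ k :=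
    Module.compHom k (ε.toAlgHom.fromOpposite fun _ _ => Commute.all _ _).toRingHom
  have act (a : A.carrier) (x : k) : MulOpposite.op a • x = ε.toAlgHom a * x := rfl
  { carrier := k
    isScalarTower := ⟨fun c a x => by
      induction a using MulOpposite.rec' with
      | h a => rw [← MulOpposite.op_smul, act, act, map_smul, smul_mul_assoc]⟩
    gr := trivialGrading k
    act_mem := fun m n x a hx ha => by
      rw [act]
      by_cases hn : n = 0
      · subst hn
        rw [add_zero]
        exact (trivialGrading k m).smul_mem (ε.toAlgHom a) hx
      · rw [ε.map_of_ne_zero n a hn ha, zero_mul]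
        exact zero_mem _
    d := 0
    d_mem := fun _ _ _ => zero_mem _
    d_d := fun _ => rfl
    leibniz := fun n x a _ => by
      rw [act (A.d a), ε.map_d]
      simp }

end TrivialModule

end DG

end

/-! The module `k_A` has a minimal semifree resolution `P`: it is free as a graded module on
generators `e i` of degree at least `0`, and `d (e i) = Σ e j * D i j` involves only generators of
strictly smaller degree. A nonzero coefficient `D i j` then has degree `deg i + 1 - deg j ≥ 2`, so
the augmentation kills it. The resolution is obtained by killing cohomology degree by degree. Thanks
to `H⁰ A ≅ k` and `H¹ A = 0`, adjoining generators of degree `n + 1` to kill the cohomology in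
degree `n + 2` creates no new cohomology in positive degrees up to `n + 2` (`IsStage.exists_succ`,
`exists_semifree_resolution`).

The generators have unbounded degree (`exists_deg_gt`). Suppose `e i` had maximal degree, and let
`a` represent a nonzero class in the top degree `s ≥ 1` of `H* A`. Then `e i * a` can be corrected
by lower generators to a cocycle. This is not a coboundary, because its coefficient at `e i` is not
one; but `P` has no cohomology in the positive degree `deg i + s`.

Such a `P` is not compact (`not_isCompactObject`). Let `P_{>n}` be the quotient of `P` on the
generators of degree greater than `n`. The projections `P → P_{>n}` combine to a morphism `P → ∐
P_{>n}`, since each generator survives only finitely many of them. If it factored through a finite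
subcoproduct, some projection `P → P_{>n}` would be zero in `D(A)`, hence null-homotopic. Minimality
forbids this: applying `ε` to the coefficient of a surviving generator gives `1 = 0`.

The argument can be made with actual morphisms because maps in `D(A)` out of a semifree module are
homotopy classes of morphisms (`toDerivedCat_map_surjective`, `toDerivedCat_map_eq_iff`). This also
makes direct sums of semifree modules coproducts in `D(A)`. -/

noncomputable section

namespace DG

open MulOpposite

variable {k : Type u} [Field k] {A : DGAlgebra k}

/-! ### Signs -/

section Units

lemma map_unit_smul {V W F : Type*} [AddCommGroup V] [AddCommGroup W] [FunLike F V W]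
    [AddMonoidHomClass F V W] (f : F) (s : ℤˣ) (x : V) : f (s • x) = s • f x := by
  rcases Int.units_eq_one_or s with rfl | rfl <;> simp [Units.smul_def]

lemma unit_smul_mem {V : Type*} [AddCommGroup V] [Module k V] (S : Submodule k V) (s : ℤˣ) {x : V}
    (hx : x ∈ S) : s • x ∈ S := by
  rcases Int.units_eq_one_or s with rfl | rfl <;> simpa [Units.smul_def] using hx

lemma unit_smul_smul_self {V : Type*} [AddCommGroup V] (s : ℤˣ) (x : V) : s • s • x = x := by
  rcases Int.units_eq_one_or s with rfl | rfl <;> simp [Units.smul_def]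

end Units

namespace DGAlgebra

lemma one_mem (A : DGAlgebra k) : (1 : A.carrier) ∈ A.gr 0 := SetLike.GradedOne.one_mem

lemma d_one (A : DGAlgebra k) : A.d 1 = 0 := by
  have h := A.leibniz 0 1 1 A.one_mem
  simpa using h

end DGAlgebra

/-! ### Right linear extension -/

section RightLift

variable {I : Type u} {C : Type*} [AddCommGroup C] [Module k C] [Module A.carrierᵐᵒᵖ C]

lemma op_smul_single (i : I) (a b : A.carrier) :
    op b • Finsupp.single i a = Finsupp.single i (a * b) := by
  rw [Finsupp.smul_single, op_smul_eq_mul]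

/-- Two right `A`-linear maps out of a free module agree if they agree on the generators. -/
lemma rightLinear_ext {f g : (I →₀ A.carrier) →ₗ[k] C}
    (hf : ∀ (x : I →₀ A.carrier) (a : A.carrier), f (op a • x) = op a • f x)
    (hg : ∀ (x : I →₀ A.carrier) (a : A.carrier), g (op a • x) = op a • g x)
    (h : ∀ i, f (Finsupp.single i 1) = g (Finsupp.single i 1)) : f = g := by
  ext i a
  have e : Finsupp.single i a = op a • Finsupp.single i (1 : A.carrier) := by
    rw [op_smul_single, one_mul]
  simp only [LinearMap.comp_apply, Finsupp.lsingle_apply]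
  rw [e, hf, hg, h]

variable [IsScalarTower k A.carrierᵐᵒᵖ C]

/-- Acting on a fixed element of a right module. -/
def rightSpan (c : C) : A.carrier →ₗ[k] C where
  toFun a := op a • c
  map_add' a b := by rw [MulOpposite.op_add, add_smul]
  map_smul' r a := by rw [op_smul, smul_assoc, RingHom.id_apply]

@[simp]
lemma rightSpan_apply (c : C) (a : A.carrier) : rightSpan (k := k) c a = op a • c := rfl

/-- The right `A`-linear map out of the free right module on `I` with prescribed values on the
generators. -/
def rightLift (h : I → C) : (I →₀ A.carrier) →ₗ[k] C :=
  Finsupp.lsum k fun i => rightSpan (h i)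

lemma rightLift_apply (h : I → C) (x : I →₀ A.carrier) :
    rightLift (k := k) h x = x.sum fun i a => op a • h i := rfl

@[simp]
lemma rightLift_single (h : I → C) (i : I) (a : A.carrier) :
    rightLift (k := k) h (Finsupp.single i a) = op a • h i := by
  simp [rightLift]

lemma rightLift_act (h : I → C) (x : I →₀ A.carrier) (b : A.carrier) :
    rightLift (k := k) h (op b • x) = op b • rightLift (k := k) h x := by
  induction x using Finsupp.induction_linear with
  | zero => simp
  | add x y hx hy => rw [smul_add, map_add, hx, hy, map_add, smul_add]
  | single i a => rw [op_smul_single, rightLift_single, rightLift_single, op_mul, mul_smul]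

lemma eq_rightLift {f : (I →₀ A.carrier) →ₗ[k] C}
    (hf : ∀ (x : I →₀ A.carrier) (a : A.carrier), f (op a • x) = op a • f x) :
    f = rightLift (k := k) fun i => f (Finsupp.single i 1) :=
  rightLinear_ext hf (rightLift_act _) fun i => by simp

lemma rightLift_congr {h h' : I → C} {x : I →₀ A.carrier} (H : ∀ i, x i ≠ 0 → h i = h' i) :
    rightLift (k := k) h x = rightLift (k := k) h' x :=
  Finsupp.sum_congr fun i hi => by
    simp only [rightSpan_apply, H i (Finsupp.mem_support_iff.1 hi)]

end RightLift

/-! ### Semifree differentials -/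

section SemifreeDiff

variable {I : Type u} (deg : I → ℕ) (D : I → I →₀ A.carrier)

/-- The homogeneous components of the free right module on generators of given degrees. -/
def semifreeGr (n : ℤ) : Submodule k (I →₀ A.carrier) :=
  ⨅ i, (A.gr (n - deg i)).comap (Finsupp.lapply i)

variable {deg} in
lemma mem_semifreeGr {n : ℤ} {x : I →₀ A.carrier} :
    x ∈ semifreeGr deg n ↔ ∀ i, x i ∈ A.gr (n - deg i) := by
  simp [semifreeGr]

variable {deg} in
lemma single_mem_semifreeGr {n : ℤ} {i : I} {a : A.carrier} (ha : a ∈ A.gr (n - deg i)) :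
    Finsupp.single i a ∈ semifreeGr deg n := by
  classical
  rw [mem_semifreeGr]
  intro j
  rw [Finsupp.single_apply]
  split_ifs with h
  · exact h ▸ ha
  · exact zero_mem _

lemma single_one_mem_semifreeGr (i : I) :
    Finsupp.single i (1 : A.carrier) ∈ semifreeGr deg (deg i : ℤ) :=
  single_mem_semifreeGr (by simpa using A.one_mem)

lemma act_mem_semifreeGr (m n : ℤ) (x : I →₀ A.carrier) (a : A.carrier)
    (hx : x ∈ semifreeGr deg m) (ha : a ∈ A.gr n) : op a • x ∈ semifreeGr deg (m + n) := by
  rw [mem_semifreeGr] at hx ⊢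
  intro i
  have h : x i * a ∈ A.gr (m - deg i + n) := SetLike.mul_mem_graded (hx i) ha
  rw [show m + n - deg i = m - deg i + n by ring]
  exact h

/-- A right linear map with homogeneous values on the generators is homogeneous. -/
lemma rightLift_mem {C : Type*} [AddCommGroup C] [Module k C] [Module A.carrierᵐᵒᵖ C]
    [IsScalarTower k A.carrierᵐᵒᵖ C] (gr : ℤ → Submodule k C)
    (act_mem : ∀ (m n : ℤ) (x : C) (a : A.carrier), x ∈ gr m → a ∈ A.gr n → op a • x ∈ gr (m + n))
    (r : ℤ) {h : I → C} {n : ℤ} {x : I →₀ A.carrier} (hx : x ∈ semifreeGr deg n)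
    (hh : ∀ i, x i ≠ 0 → h i ∈ gr (deg i + r)) : rightLift (k := k) h x ∈ gr (n + r) := by
  rw [rightLift_apply]
  refine Submodule.sum_mem _ fun i hi => ?_
  have := act_mem _ _ _ _ (hh i (Finsupp.mem_support_iff.1 hi)) (mem_semifreeGr.1 hx i)
  rwa [show (deg i : ℤ) + r + (n - deg i) = n + r by ring] at this

/-- The differential acting on coefficients only. -/
def coeffDiff : (I →₀ A.carrier) →ₗ[k] (I →₀ A.carrier) :=
  Finsupp.lsum k fun i => (deg i : ℤ).negOnePow • (Finsupp.lsingle i ∘ₗ A.d)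

@[simp]
lemma coeffDiff_single (i : I) (a : A.carrier) :
    coeffDiff (A := A) deg (Finsupp.single i a) =
      (deg i : ℤ).negOnePow • Finsupp.single i (A.d a) := by
  simp [coeffDiff]

@[simp]
lemma coeffDiff_apply (x : I →₀ A.carrier) (i : I) :
    coeffDiff deg x i = (deg i : ℤ).negOnePow • A.d (x i) := by
  classical
  induction x using Finsupp.induction_linear with
  | zero => simp
  | add x y hx hy => rw [map_add, Finsupp.add_apply, hx, hy, Finsupp.add_apply, map_add, smul_add]
  | single j a =>
    rw [coeffDiff_single, Finsupp.smul_apply, Finsupp.single_apply, Finsupp.single_apply]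
    split_ifs with h
    · rw [h]
    · simp

/-- The differential of a semifree module: `d (e i * a) = D i * a ± e i * d a`. -/
def semifreeDiff : (I →₀ A.carrier) →ₗ[k] (I →₀ A.carrier) :=
  rightLift (k := k) D + coeffDiff deg

lemma semifreeDiff_eq (x : I →₀ A.carrier) :
    semifreeDiff deg D x = rightLift (k := k) D x + coeffDiff deg x := rfl

@[simp]
lemma semifreeDiff_single (i : I) (a : A.carrier) :
    semifreeDiff deg D (Finsupp.single i a) =
      op a • D i + (deg i : ℤ).negOnePow • Finsupp.single i (A.d a) := by
  simp [semifreeDiff]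

lemma semifreeDiff_single_one (i : I) :
    semifreeDiff deg D (Finsupp.single i 1) = D i := by
  simp [A.d_one]

lemma semifreeDiff_leibniz (n : ℤ) (x : I →₀ A.carrier) (b : A.carrier)
    (hx : x ∈ semifreeGr deg n) :
    semifreeDiff deg D (op b • x) =
      op b • semifreeDiff deg D x + n.negOnePow • (op (A.d b) • x) := by
  rw [semifreeDiff_eq, semifreeDiff_eq, rightLift_act, smul_add, add_assoc]
  congr 1
  ext i
  have h := A.leibniz _ _ b (mem_semifreeGr.1 hx i)
  simp only [coeffDiff_apply, Finsupp.smul_apply, Finsupp.add_apply, op_smul_eq_mul]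
  rw [h, smul_add, smul_mul_assoc, smul_smul, ← Int.negOnePow_add]
  congr 3
  ring

-- Here and below, conditions on `D` are imposed only on the support of `x`: the resolution is cut
-- out of a larger family of generators that need not satisfy them.
variable {deg D} in
lemma semifreeDiff_mem {n : ℤ} {x : I →₀ A.carrier} (hx : x ∈ semifreeGr deg n)
    (hD : ∀ i, x i ≠ 0 → D i ∈ semifreeGr deg (deg i + 1)) :
    semifreeDiff deg D x ∈ semifreeGr deg (n + 1) := by
  refine add_mem (rightLift_mem deg _ (act_mem_semifreeGr deg) 1 hx hD) ?_
  rw [mem_semifreeGr]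
  intro i
  rw [coeffDiff_apply]
  have := A.d_mem _ _ (mem_semifreeGr.1 hx i)
  rw [show n + 1 - deg i = n - deg i + 1 by ring]
  exact unit_smul_mem _ _ this

variable {deg D} in
lemma semifreeDiff_semifreeDiff {x : I →₀ A.carrier}
    (hD : ∀ i, x i ≠ 0 → D i ∈ semifreeGr deg (deg i + 1))
    (hdD : ∀ i, x i ≠ 0 → semifreeDiff deg D (D i) = 0) :
    semifreeDiff deg D (semifreeDiff deg D x) = 0 := by
  have key (i : I) (hi : x i ≠ 0) (a : A.carrier) :
      semifreeDiff deg D (semifreeDiff deg D (Finsupp.single i a)) = 0 := by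
    rw [semifreeDiff_single, map_add, semifreeDiff_leibniz deg D _ _ a (hD i hi), hdD i hi,
      map_unit_smul, semifreeDiff_single, A.d_d]
    simp [Int.negOnePow_succ]
  rw [← Finsupp.sum_single x, Finsupp.sum, map_sum, map_sum]
  exact Finset.sum_eq_zero fun i hi => key i (Finsupp.mem_support_iff.1 hi) _

end SemifreeDiff

/-! ### Homogeneous decomposition of free graded modules -/

section Decomposition

variable {I : Type u} (deg : I → ℕ)

/-- The inclusion of a homogeneous component of `A` as multiples of a generator. -/
def singleGr (i : I) (m : ℤ) : A.gr m →ₗ[k] semifreeGr (A := A) deg (m + deg i) :=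
  (Finsupp.lsingle i ∘ₗ (A.gr m).subtype).codRestrict _ fun a =>
    single_mem_semifreeGr (by simp)

/-- The decomposition of an element of a free graded module into its homogeneous parts. -/
def semifreeDecompose : (I →₀ A.carrier) →ₗ[k] DirectSum ℤ fun n => semifreeGr (A := A) deg n :=
  Finsupp.lsum k fun i =>
    (DirectSum.toModule k ℤ _ fun m =>
      DirectSum.lof k ℤ (fun n => semifreeGr (A := A) deg n) (m + deg i) ∘ₗ singleGr deg i m) ∘ₗ
    (DirectSum.decomposeLinearEquiv A.gr).toLinearMap

lemma semifreeDecompose_single (i : I) {n : ℤ} {a : A.carrier} (ha : a ∈ A.gr (n - deg i)) :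
    semifreeDecompose deg (Finsupp.single i a) =
      DirectSum.lof k ℤ (fun n => semifreeGr (A := A) deg n) n
        ⟨Finsupp.single i a, single_mem_semifreeGr ha⟩ := by
  obtain ⟨m, rfl⟩ : ∃ m, n = m + deg i := ⟨n - deg i, by ring⟩
  have ha' : a ∈ A.gr m := by simpa using ha
  have h : DirectSum.decompose A.gr a = DirectSum.lof k ℤ (fun n => A.gr n) m ⟨a, ha'⟩ :=
    DirectSum.decompose_of_mem _ ha'
  simp only [semifreeDecompose, Finsupp.lsum_single, LinearMap.comp_apply, LinearEquiv.coe_coe,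
    DirectSum.decomposeLinearEquiv_apply]
  rw [h, DirectSum.toModule_lof]
  rfl

instance semifreeDecomposition :
    DirectSum.Decomposition (semifreeGr (A := A) deg) :=
  .ofLinearMap _ (semifreeDecompose deg)
    (by
      ext i a : 2
      simp only [LinearMap.comp_apply, Finsupp.lsingle_apply, LinearMap.id_apply]
      induction a using DirectSum.Decomposition.inductionOn A.gr with
      | zero => simp
      | add a b ha hb => rw [Finsupp.single_add, map_add, map_add, ha, hb]
      | @homogeneous m a =>
        rw [semifreeDecompose_single deg i (n := m + deg i) (by simp)]
        exact DirectSum.coeLinearMap_lof (R := k) _ _ _)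
    (by
      ext n x : 2
      simp only [LinearMap.comp_apply, LinearMap.id_apply, DirectSum.coeLinearMap_lof]
      obtain ⟨x, hx⟩ := x
      rw [mem_semifreeGr] at hx
      have e : (⟨x, mem_semifreeGr.2 hx⟩ : semifreeGr (A := A) deg n) =
          ∑ i ∈ x.support, ⟨Finsupp.single i (x i), single_mem_semifreeGr (hx i)⟩ := by
        apply Subtype.ext
        simp only [AddSubmonoidClass.coe_finsetSum]
        exact (Finsupp.sum_single x).symm
      rw [e, map_sum, AddSubmonoidClass.coe_finsetSum, map_sum]
      exact Finset.sum_congr rfl fun i _ => semifreeDecompose_single deg i (hx i))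

end Decomposition

/-- Generators of a semifree module: the differential of a generator involves only generators of
smaller degree. -/
structure SemifreeData (A : DGAlgebra k) where
  I : Type u
  deg : I → ℕ
  D : I → I →₀ A.carrier
  D_mem : ∀ i, D i ∈ semifreeGr deg (deg i + 1)
  D_lt : ∀ i j, D i j ≠ 0 → deg j < deg i
  d_D : ∀ i, semifreeDiff deg D (D i) = 0

namespace SemifreeData

variable (P : SemifreeData A)

/-- The semifree differential graded module on the given generators. -/
abbrev toDGModule : DGModule A where
  carrier := P.I →₀ A.carrier
  gr := semifreeGr P.deg
  decomposition := semifreeDecomposition P.deg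
  act_mem := act_mem_semifreeGr P.deg
  d := semifreeDiff P.deg P.D
  d_mem _ _ hx := semifreeDiff_mem hx fun i _ => P.D_mem i
  d_d _ := semifreeDiff_semifreeDiff (fun i _ => P.D_mem i) fun i _ => P.d_D i
  leibniz n x a hx := semifreeDiff_leibniz P.deg P.D n x a hx

end SemifreeData

/-! ### Maps into acyclic complexes -/

section Acyclic

variable {I : Type u} {C : Type*} [AddCommGroup C] [Module k C] [Module A.carrierᵐᵒᵖ C]
  [IsScalarTower k A.carrierᵐᵒᵖ C]

lemma rightLift_rightLift {J : Type u} (h : J → C) (D : I → J →₀ A.carrier) (x : I →₀ A.carrier) :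
    rightLift (k := k) h (rightLift (k := k) D x) =
      rightLift (k := k) (fun i => rightLift (k := k) h (D i)) x :=
  LinearMap.congr_fun (rightLinear_ext (k := k)
    (f := rightLift (k := k) h ∘ₗ rightLift (k := k) D) (fun x a => by simp [rightLift_act])
    (rightLift_act _) fun i => by simp) x

variable (gr : ℤ → Submodule k C) (d : C →ₗ[k] C)
  (leibniz : ∀ (n : ℤ) (x : C) (a : A.carrier), x ∈ gr n →
    d (op a • x) = op a • d x + n.negOnePow • (op (A.d a) • x))
include leibniz

/-- The differential of the value of a right linear map with homogeneous values on generators. -/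
lemma d_rightLift {deg : I → ℕ} (h : I → C) (r : ℤ) (x : I →₀ A.carrier)
    (hh : ∀ i, x i ≠ 0 → h i ∈ gr (deg i + r)) :
    d (rightLift (k := k) h x) = rightLift (k := k) (fun i => d (h i)) x +
      r.negOnePow • rightLift (k := k) h (coeffDiff deg x) := by
  have key (i : I) (hi : x i ≠ 0) (a : A.carrier) : d (rightLift (k := k) h (Finsupp.single i a)) =
      rightLift (k := k) (fun i => d (h i)) (Finsupp.single i a) +
        r.negOnePow • rightLift (k := k) h (coeffDiff deg (Finsupp.single i a)) := by
    rw [rightLift_single, leibniz _ _ _ (hh i hi), rightLift_single, coeffDiff_single,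
      map_unit_smul, rightLift_single, smul_smul, ← Int.negOnePow_add, add_comm r]
  conv_lhs => rw [← Finsupp.sum_single x, Finsupp.sum, map_sum, map_sum]
  conv_rhs => rw [← Finsupp.sum_single x, Finsupp.sum, map_sum, map_sum, map_sum, Finset.smul_sum,
    ← Finset.sum_add_distrib]
  exact Finset.sum_congr rfl fun i hi => key i (Finsupp.mem_support_iff.1 hi) _

/-- The first term extends linearly the failure of `h` to commute with the differentials on
generators. Identities for chain maps and homotopies are thereby reduced to generators. -/
lemma d_rightLift_eq {deg : I → ℕ} {D : I → I →₀ A.carrier} (h : I → C) (r : ℤ) (x : I →₀ A.carrier)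
    (hh : ∀ i, x i ≠ 0 → h i ∈ gr (deg i + r)) :
    d (rightLift (k := k) h x) =
      rightLift (k := k) (fun i => d (h i) - r.negOnePow • rightLift (k := k) h (D i)) x +
      r.negOnePow • rightLift (k := k) h (semifreeDiff deg D x) := by
  rw [d_rightLift gr d leibniz h r x hh, semifreeDiff_eq, map_add, smul_add, ← add_assoc,
    rightLift_rightLift]
  congr 1
  rw [← sub_eq_iff_eq_add]
  have : rightLift (k := k) (A := A) (fun i => d (h i) - r.negOnePow • rightLift (k := k) h (D i)) =
      rightLift (k := k) (A := A) (fun i => d (h i)) -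
        r.negOnePow • rightLift (k := k) (A := A) fun i => rightLift (k := k) h (D i) := by
    ext i a
    simp only [LinearMap.comp_apply, Finsupp.lsingle_apply, LinearMap.sub_apply,
      LinearMap.smul_apply, rightLift_single, smul_sub]
    rw [smul_comm]
  rw [this]
  simp

/-- A homogeneous right linear map of degree `r` from a semifree module to an acyclic complex that
commutes with the differentials up to the sign `(-1) ^ r` is null-homotopic. -/
lemma SemifreeData.exists_nullHomotopy (P : SemifreeData A)
    (act_mem : ∀ (m n : ℤ) (x : C) (a : A.carrier), x ∈ gr m → a ∈ A.gr n → op a • x ∈ gr (m + n))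
    (acyclic : ∀ (n : ℤ) (x : C), x ∈ gr n → d x = 0 → ∃ y ∈ gr (n - 1), d y = x)
    (r : ℤ) (f : P.I → C) (hf : ∀ i, f i ∈ gr (P.deg i + r))
    (hdf : ∀ i, d (f i) = r.negOnePow • rightLift (k := k) f (P.D i)) :
    ∃ h : P.I → C, (∀ i, h i ∈ gr (P.deg i + (r - 1))) ∧
      ∀ i, f i = d (h i) + r.negOnePow • rightLift (k := k) h (P.D i) := by
  classical
  choose! solve hsolve hdsolve using acyclic
  -- Recursion on the degree. Only generators of smaller degree occur in `D i`, so the default value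
  -- `0` is never used; this gives `h_eq`.
  let h : P.I → C := WellFounded.fix (measure P.deg).wf fun i rec =>
    solve (P.deg i + r) (f i - r.negOnePow • rightLift (k := k)
      (fun j => if hj : P.deg j < P.deg i then rec j hj else 0) (P.D i))
  have h_eq (i : P.I) : h i = solve (P.deg i + r)
      (f i - r.negOnePow • rightLift (k := k) h (P.D i)) := by
    refine (WellFounded.fix_eq _ _ _).trans ?_
    congr 3
    exact rightLift_congr fun j hj => dif_pos (P.D_lt i j hj)
  have key (n : ℕ) : ∀ i, P.deg i < n → h i ∈ gr (P.deg i + (r - 1)) ∧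
      d (h i) = f i - r.negOnePow • rightLift (k := k) h (P.D i) := by
    induction n with
    | zero => intro i hi; omega
    | succ n ih =>
      intro i hi
      have ih' (j : P.I) (hj : P.D i j ≠ 0) := ih j (by have := P.D_lt i j hj; omega)
      have mem : rightLift (k := k) h (P.D i) ∈ gr (P.deg i + r) := by
        have := rightLift_mem P.deg gr act_mem (r - 1) (P.D_mem i) fun j hj => (ih' j hj).1
        rwa [show (P.deg i : ℤ) + 1 + (r - 1) = P.deg i + r by ring] at this
      have mem' : f i - r.negOnePow • rightLift (k := k) h (P.D i) ∈ gr (P.deg i + r) :=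
        sub_mem (hf i) (unit_smul_mem _ _ mem)
      -- The right-hand side is a cocycle: by induction the failure of `h` to commute with the
      -- differentials on the generators in `D i` is `f`, and `d (D i) = 0`.
      have hd : d (f i - r.negOnePow • rightLift (k := k) h (P.D i)) = 0 := by
        rw [map_sub, hdf, map_unit_smul,
          d_rightLift_eq gr d leibniz (D := P.D) h (r - 1) (P.D i) fun j hj => (ih' j hj).1,
          P.d_D, map_zero, smul_zero, add_zero, ← smul_sub]
        have e : rightLift (k := k) (fun j => d (h j) -
            (r - 1).negOnePow • rightLift (k := k) h (P.D j)) (P.D i) =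
            rightLift (k := k) f (P.D i) := by
          refine rightLift_congr fun j hj => ?_
          rw [(ih' j hj).2, Int.negOnePow_sub]
          simp
        rw [e, sub_self, smul_zero]
      rw [h_eq i]
      refine ⟨?_, hdsolve _ _ mem' hd⟩
      have := hsolve _ _ mem' hd
      rwa [show (P.deg i : ℤ) + (r - 1) = P.deg i + r - 1 by ring]
  refine ⟨h, fun i => (key _ i (Nat.lt_succ_self _)).1, fun i => ?_⟩
  rw [(key _ i (Nat.lt_succ_self _)).2, sub_add_cancel]

end Acyclic

/-! ### Morphisms in localisations out of colocal objects -/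

/-- If `Hom(P, -)` inverts `W`, then the localisation functor at `W` is bijective on morphisms out
of `P`. -/
lemma bijective_Q_map {C : Type v} [Category.{w} C] (W : MorphismProperty C) (P : C)
    (hP : ∀ ⦃X Y : C⦄ (f : X ⟶ Y), W f → Function.Bijective fun g : P ⟶ X => g ≫ f) (X : C) :
    Function.Bijective (W.Q.map : (P ⟶ X) → (W.Q.obj P ⟶ W.Q.obj X)) := by
  have hinv : W.IsInvertedBy (coyoneda.obj (Opposite.op P)) := fun X Y f hf =>
    (isIso_iff_bijective _).2 (hP f hf)
  constructor
  · intro a b hab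
    let e := Localization.fac (coyoneda.obj (Opposite.op P)) hinv W.Q
    -- `Hom(P, -)` extends to the localisation, and `c` is recovered from `Q c` by evaluating this
    -- extension at the identity of `P`.
    have h (c : P ⟶ X) : c = e.hom.app X ((Localization.lift (coyoneda.obj (Opposite.op P)) hinv
        W.Q).map (W.Q.map c) (e.inv.app P (𝟙 P))) := by
      have := ConcreteCategory.congr_hom (e.hom.naturality c) (e.inv.app P (𝟙 P))
      simp at this
      exact this.symm
    rw [h a, h b, hab]
  · intro φ
    -- `R` holds for `φ` if composing with `φ` preserves the morphisms out of `P` that lie in the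
    -- image of `Q`. It contains the generating morphisms of the localisation and is stable under
    -- composition.
    let R : MorphismProperty W.Localization := fun U V φ =>
      ∀ a : P ⟶ U.as.obj, ∃ b : P ⟶ V.as.obj, (W.Q.map a : W.Q.obj P ⟶ U) ≫ φ = W.Q.map b
    have : R.IsStableUnderComposition := ⟨fun f g hf hg a => by
      obtain ⟨b, hb⟩ := hf a
      obtain ⟨c, hc⟩ := hg b
      exact ⟨c, (Category.assoc _ _ _).symm.trans ((congrArg (· ≫ g) hb).trans hc)⟩⟩
    have hR : R = ⊤ := by
      refine Localization.Construction.morphismProperty_eq_top R (fun X Y f a => ?_)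
        fun X Y f hf a => ?_
      · exact ⟨a ≫ f, (W.Q.map_comp a f).symm⟩
      · obtain ⟨b, rfl⟩ := (hP f hf).2 a
        refine ⟨b, ?_⟩
        change W.Q.map (b ≫ f) ≫ (Localization.Construction.wIso f hf).inv = W.Q.map b
        rw [W.Q.map_comp, Category.assoc]
        exact (congrArg (W.Q.map b ≫ ·) (Localization.Construction.wIso f hf).hom_inv_id).trans
          (Category.comp_id _)
    have h : R φ := hR ▸ trivial
    obtain ⟨b, hb⟩ := h (𝟙 P)
    refine ⟨b, hb.symm.trans ?_⟩
    exact (congrArg (· ≫ φ) (W.Q.map_id P)).trans (Category.id_comp φ)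

/-! ### Homotopy -/

instance (A : DGAlgebra k) : Congruence (DGModule.homotopic A) where
  comp_left f g g' := by
    rintro ⟨h, h1, h2, h3⟩
    exact ⟨h ∘ₗ f.toLinearMap, fun x a => by simp [f.map_act, h1],
      fun n x hx => h2 n _ (f.map_mem n x hx), fun x => by simpa [f.map_d] using h3 (f.toLinearMap x)⟩
  comp_right g := by
    rintro ⟨h, h1, h2, h3⟩
    exact ⟨g.toLinearMap ∘ₗ h, fun x a => by simp [g.map_act, h1],
      fun n x hx => g.map_mem _ _ (h2 n x hx), fun x => by
        simpa [g.map_d] using congrArg g.toLinearMap (h3 x)⟩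
  equivalence :=
    { refl := fun f => ⟨0, by simp, fun _ _ _ => zero_mem _, by simp⟩
      symm := by
        rintro f g ⟨h, h1, h2, h3⟩
        exact ⟨-h, fun x a => by simp [h1], fun n x hx => neg_mem (h2 n x hx), fun x => by
          rw [← neg_sub, h3]; simp [add_comm]⟩
      trans := by
        rintro f g l ⟨h, h1, h2, h3⟩ ⟨h', h1', h2', h3'⟩
        exact ⟨h + h', fun x a => by simp [h1, h1'], fun n x hx => add_mem (h2 n x hx) (h2' n x hx),
          fun x => by
            rw [← sub_add_sub_cancel _ (g.toLinearMap x), h3, h3']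
            simp only [LinearMap.add_apply, map_add]
            abel⟩ }

section RightLiftMore

variable {I : Type u} {C C' : Type*} [AddCommGroup C] [Module k C] [Module A.carrierᵐᵒᵖ C]
  [IsScalarTower k A.carrierᵐᵒᵖ C] [AddCommGroup C'] [Module k C'] [Module A.carrierᵐᵒᵖ C']
  [IsScalarTower k A.carrierᵐᵒᵖ C']

lemma map_rightLift (φ : C →ₗ[k] C') (hφ : ∀ (x : C) (a : A.carrier), φ (op a • x) = op a • φ x)
    (h : I → C) (x : I →₀ A.carrier) :
    φ (rightLift (k := k) h x) = rightLift (k := k) (fun i => φ (h i)) x :=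
  LinearMap.congr_fun (rightLinear_ext (f := φ ∘ₗ rightLift (k := k) h)
    (fun x a => by simp [rightLift_act, hφ]) (rightLift_act _) fun i => by simp) x

lemma rightLift_sub (h h' : I → C) (x : I →₀ A.carrier) :
    rightLift (k := k) (fun i => h i - h' i) x =
      rightLift (k := k) h x - rightLift (k := k) h' x := by
  simp [rightLift_apply, smul_sub, Finsupp.sum_sub]

lemma rightLift_neg (h : I → C) (x : I →₀ A.carrier) :
    rightLift (k := k) (fun i => -h i) x = -rightLift (k := k) h x := by
  simp [rightLift_apply, Finsupp.sum_neg]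

end RightLiftMore

/-! ### Morphisms and homotopies out of semifree modules -/

namespace SemifreeData

variable (P : SemifreeData A) {Z : DGModule A}

/-- The generator with index `i`. -/
def gen (i : P.I) : P.toDGModule.carrier := (Finsupp.single i 1 : P.I →₀ A.carrier)

lemma gen_mem (i : P.I) : P.gen i ∈ P.toDGModule.gr (P.deg i) :=
  single_one_mem_semifreeGr P.deg i

lemma d_gen (i : P.I) : P.toDGModule.d (P.gen i) = P.D i :=
  semifreeDiff_single_one P.deg P.D i

/-- The morphism of differential graded modules with prescribed values on the generators. -/
def homMk (f : P.I → Z.carrier) (hf : ∀ i, f i ∈ Z.gr (P.deg i))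
    (hdf : ∀ i, Z.d (f i) = rightLift (k := k) f (P.D i)) : P.toDGModule ⟶ Z where
  toLinearMap := rightLift (k := k) f
  map_act x a := rightLift_act f x a
  map_mem n x hx := by
    have := rightLift_mem (h := f) P.deg Z.gr Z.act_mem 0 hx (fun i _ => by simpa using hf i)
    rwa [add_zero] at this
  map_d x := by
    have := d_rightLift_eq Z.gr Z.d Z.leibniz (deg := P.deg) (D := P.D) f 0 x
      (fun i _ => by simpa using hf i)
    simp only [Int.negOnePow_zero, one_smul, hdf, sub_self] at this
    rw [this]
    have h0 : rightLift (k := k) (fun _ : P.I => (0 : Z.carrier)) x = 0 := by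
      simp [rightLift_apply]
    rw [h0, zero_add]

lemma homMk_toLinearMap (f : P.I → Z.carrier) (hf : ∀ i, f i ∈ Z.gr (P.deg i))
    (hdf : ∀ i, Z.d (f i) = rightLift (k := k) f (P.D i)) :
    (P.homMk f hf hdf).toLinearMap = rightLift (k := k) f := rfl

@[simp]
lemma homMk_gen (f : P.I → Z.carrier) (hf : ∀ i, f i ∈ Z.gr (P.deg i))
    (hdf : ∀ i, Z.d (f i) = rightLift (k := k) f (P.D i)) (i : P.I) :
    (P.homMk f hf hdf).toLinearMap (P.gen i) = f i := by
  rw [homMk_toLinearMap, gen]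
  simp

variable {P}

lemma hom_eq_rightLift (f : P.toDGModule ⟶ Z) (x : P.I →₀ A.carrier) :
    f.toLinearMap x = rightLift (k := k) (fun i => f.toLinearMap (P.gen i)) x :=
  LinearMap.congr_fun (eq_rightLift (I := P.I) (f := f.toLinearMap) f.map_act) x

lemma hom_ext {f g : P.toDGModule ⟶ Z}
    (h : ∀ i, f.toLinearMap (P.gen i) = g.toLinearMap (P.gen i)) : f = g := by
  refine DGModule.Hom.ext (LinearMap.ext fun x => ?_)
  rw [hom_eq_rightLift, hom_eq_rightLift, funext h]

lemma d_hom_gen (f : P.toDGModule ⟶ Z) (i : P.I) : Z.d (f.toLinearMap (P.gen i)) =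
    rightLift (k := k) (fun i => f.toLinearMap (P.gen i)) (P.D i) := by
  rw [← f.map_d, d_gen]
  exact hom_eq_rightLift f (P.D i)

/-- A homotopy may be given by its values on the generators. -/
lemma homotopic_of_gen {f g : P.toDGModule ⟶ Z} (h : P.I → Z.carrier)
    (hdeg : ∀ i, h i ∈ Z.gr (P.deg i - 1))
    (hd : ∀ i, f.toLinearMap (P.gen i) - g.toLinearMap (P.gen i) =
      Z.d (h i) + rightLift (k := k) h (P.D i)) : DGModule.homotopic A f g := by
  refine ⟨rightLift (k := k) h, rightLift_act h, fun n x hx =>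
    rightLift_mem P.deg Z.gr Z.act_mem (-1) hx fun i _ => hdeg i, fun x => ?_⟩
  have := d_rightLift_eq Z.gr Z.d Z.leibniz (deg := P.deg) (D := P.D) h (-1) x fun i _ => by
      rw [← sub_eq_add_neg]; exact hdeg i
  rw [this, hom_eq_rightLift f, hom_eq_rightLift g, ← rightLift_sub]
  simp only [hd]
  change _ = _ + rightLift (k := k) h (semifreeDiff P.deg P.D x)
  simp

end SemifreeData

/-! ### Quasi-isomorphisms -/

section QuasiIso

lemma quasiIso_functor_map_iff {X Y : DGModule A} (w : X ⟶ Y) :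
    quasiIso A ((CategoryTheory.Quotient.functor (DGModule.homotopic A)).map w) ↔
      ∀ n, Function.Bijective (DGModule.cohomologyMap w n) :=
  forall_congr' fun n =>
    ConcreteCategory.isIso_iff_bijective ((DGModule.cohomologyFunctor A n).map w)

/-- The mapping cone of a quasi-isomorphism is acyclic. -/
lemma exists_cone_primitive {X Y : DGModule A} (w : X ⟶ Y)
    (hw : ∀ n, Function.Bijective (DGModule.cohomologyMap w n)) {n : ℤ} {x : X.carrier}
    {y : Y.carrier} (hx : x ∈ X.gr (n + 1)) (hy : y ∈ Y.gr n) (hdx : X.d x = 0)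
    (hxy : w.toLinearMap x = Y.d y) :
    ∃ x' ∈ X.gr n, ∃ y' ∈ Y.gr (n - 1), X.d x' = x ∧ y - w.toLinearMap x' = Y.d y' := by
  obtain ⟨x₁, hx₁, hdx₁⟩ : ∃ x₁ ∈ X.gr n, X.d x₁ = x := by
    have h : (Submodule.Quotient.mk ⟨x, hx, hdx⟩ : X.H (n + 1)) = 0 := by
      apply (hw (n + 1)).1
      rw [map_zero]
      refine (Submodule.Quotient.mk_eq_zero _).2 ⟨y, ?_, hxy.symm⟩
      simpa using hy
    obtain ⟨x₁, hx₁, e⟩ := (Submodule.Quotient.mk_eq_zero _).1 h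
    exact ⟨x₁, by simpa using hx₁, e⟩
  have hz : y - w.toLinearMap x₁ ∈ cocycles Y.gr Y.d n :=
    ⟨sub_mem hy (w.map_mem _ _ hx₁), by
      change Y.d _ = 0
      rw [map_sub, ← w.map_d, hdx₁, hxy, sub_self]⟩
  obtain ⟨c, hc⟩ := (hw n).2 (Submodule.Quotient.mk ⟨_, hz⟩)
  obtain ⟨⟨x₂, hx₂, hdx₂⟩, rfl⟩ := Submodule.Quotient.mk_surjective _ c
  obtain ⟨y', hy', e⟩ := (Submodule.Quotient.eq _).1 hc
  have e : Y.d y' = w.toLinearMap x₂ - (y - w.toLinearMap x₁) := e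
  refine ⟨x₁ + x₂, add_mem hx₁ hx₂, -y', neg_mem hy', ?_, ?_⟩
  · rw [map_add, hdx₁, LinearMap.mem_ker.1 hdx₂, add_zero]
  · rw [map_neg, e, map_add]
    abel

/-- The grading of the mapping cone of a morphism `X ⟶ Y`. -/
def coneGr (X Y : DGModule A) (n : ℤ) : Submodule k (X.carrier × Y.carrier) :=
  (X.gr (n + 1)).prod (Y.gr n)

/-- The differential of the mapping cone. -/
def coneDiff {X Y : DGModule A} (w : X ⟶ Y) :
    (X.carrier × Y.carrier) →ₗ[k] (X.carrier × Y.carrier) :=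
  LinearMap.prod (-(X.d ∘ₗ LinearMap.fst k _ _))
    (Y.d ∘ₗ LinearMap.snd k _ _ + w.toLinearMap ∘ₗ LinearMap.fst k _ _)

lemma coneDiff_apply {X Y : DGModule A} (w : X ⟶ Y) (x : X.carrier) (y : Y.carrier) :
    coneDiff w (x, y) = (-X.d x, Y.d y + w.toLinearMap x) := rfl

/-- The sign of `-X.d` compensates the shift of the grading on the first component; a right action
needs no further sign. -/
lemma coneDiff_leibniz {X Y : DGModule A} (w : X ⟶ Y) (n : ℤ) (z : X.carrier × Y.carrier)
    (a : A.carrier) (hz : z ∈ coneGr X Y n) : coneDiff w (op a • z) =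
      op a • coneDiff w z + n.negOnePow • (op (A.d a) • z) := by
  obtain ⟨x, y⟩ := z
  rw [Prod.smul_mk, coneDiff_apply, coneDiff_apply, X.leibniz _ _ _ hz.1, Y.leibniz _ _ _ hz.2,
    w.map_act]
  ext
  · simp [Int.negOnePow_succ, add_comm]
  · simp only [Prod.smul_mk, Prod.mk_add_mk, smul_add]
    abel

lemma coneGr_act_mem (X Y : DGModule A) (m n : ℤ) (z : X.carrier × Y.carrier) (a : A.carrier)
    (hz : z ∈ coneGr X Y m) (ha : a ∈ A.gr n) : op a • z ∈ coneGr X Y (m + n) := by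
  refine ⟨?_, Y.act_mem _ _ _ _ hz.2 ha⟩
  have := X.act_mem _ _ _ _ hz.1 ha
  rwa [show m + 1 + n = m + n + 1 by ring] at this

lemma cone_acyclic {X Y : DGModule A} (w : X ⟶ Y)
    (hw : ∀ n, Function.Bijective (DGModule.cohomologyMap w n)) (n : ℤ)
    (z : X.carrier × Y.carrier) (hz : z ∈ coneGr X Y n) (hdz : coneDiff w z = 0) :
    ∃ z' ∈ coneGr X Y (n - 1), coneDiff w z' = z := by
  obtain ⟨x, y⟩ := z
  rw [coneDiff_apply, Prod.mk_eq_zero, neg_eq_zero] at hdz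
  obtain ⟨x', hx', y', hy', h1, h2⟩ := exists_cone_primitive w hw (neg_mem hz.1) hz.2
    (by rw [map_neg, hdz.1, neg_zero]) (by
      rw [map_neg, neg_eq_iff_add_eq_zero, add_comm]; exact hdz.2)
  refine ⟨(x', y'), ⟨by simpa using hx', hy'⟩, ?_⟩
  rw [coneDiff_apply, h1, ← h2]
  simp

lemma rightLift_prod {I : Type u} {X Y : DGModule A} (h : I → X.carrier × Y.carrier)
    (x : I →₀ A.carrier) : rightLift (k := k) h x =
      (rightLift (k := k) (fun i => (h i).1) x, rightLift (k := k) (fun i => (h i).2) x) :=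
  Prod.ext (map_rightLift (LinearMap.fst k X.carrier Y.carrier) (fun _ _ => rfl) h x)
    (map_rightLift (LinearMap.snd k X.carrier Y.carrier) (fun _ _ => rfl) h x)

variable (P : SemifreeData A) {X Y : DGModule A} (w : X ⟶ Y)
  (hw : ∀ n, Function.Bijective (DGModule.cohomologyMap w n))
include hw

/-- The map `(0, f)` into the acyclic cone of `w` is null-homotopic. The first component of the
null-homotopy is a chain map `g`, and the second is a homotopy from `f` to `g ≫ w`. -/
lemma SemifreeData.exists_lift (f : P.toDGModule ⟶ Y) :
    ∃ g : P.toDGModule ⟶ X, DGModule.homotopic A f (g ≫ w) := by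
  obtain ⟨h, hdeg, hd⟩ := P.exists_nullHomotopy (coneGr X Y) (coneDiff w) (coneDiff_leibniz w)
    (coneGr_act_mem X Y) (cone_acyclic w hw) 0 (fun i => (0, f.toLinearMap (P.gen i)))
    (fun i => ⟨zero_mem _, by simpa using f.map_mem _ _ (P.gen_mem i)⟩) (fun i => by
      rw [coneDiff_apply, d_hom_gen, rightLift_prod]
      simp [rightLift_apply])
  simp only [rightLift_prod, Int.negOnePow_zero, one_smul, zero_sub] at hd hdeg
  have h1 (i : P.I) := congrArg Prod.fst (hd i)
  have h2 (i : P.I) := congrArg Prod.snd (hd i)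
  refine ⟨P.homMk (fun i => (h i).1) (fun i => by simpa using (hdeg i).1) fun i => ?_,
    homotopic_of_gen (fun i => (h i).2) (fun i => (hdeg i).2) fun i => ?_⟩
  · have : 0 = -X.d (h i).1 + rightLift (k := k) (fun i => (h i).1) (P.D i) := h1 i
    rw [eq_comm, neg_add_eq_zero] at this
    exact this
  · have : f.toLinearMap (P.gen i) = Y.d (h i).2 + w.toLinearMap (h i).1 +
      rightLift (k := k) (fun i => (h i).2) (P.D i) := h2 i
    rw [this, DGModule.comp_toLinearMap, LinearMap.comp_apply, homMk_gen]
    abel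

/-- A homotopy `y` from `g ≫ w` to `g' ≫ w` turns `(g - g', -y)` into a map of degree `-1` to the
cone that commutes with the differentials up to sign. The first component of a null-homotopy is, up
to sign, a homotopy from `g` to `g'`. -/
lemma SemifreeData.homotopic_of_comp {g g' : P.toDGModule ⟶ X}
    (hg : DGModule.homotopic A (g ≫ w) (g' ≫ w)) : DGModule.homotopic A g g' := by
  obtain ⟨y, hy1, hy2, hy3⟩ := hg
  have hyD (i : P.I) : y (P.D i) = rightLift (k := k) (fun i => y (P.gen i)) (P.D i) :=
    LinearMap.congr_fun (eq_rightLift (I := P.I) (f := y) hy1) (P.D i)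
  have hy3' (i : P.I) : w.toLinearMap (g.toLinearMap (P.gen i) - g'.toLinearMap (P.gen i)) =
      Y.d (y (P.gen i)) + rightLift (k := k) (fun i => y (P.gen i)) (P.D i) := by
    rw [map_sub, ← hyD, ← d_gen]
    exact hy3 (P.gen i)
  obtain ⟨h, hdeg, hd⟩ := P.exists_nullHomotopy (coneGr X Y) (coneDiff w) (coneDiff_leibniz w)
    (coneGr_act_mem X Y) (cone_acyclic w hw) (-1)
    (fun i => (g.toLinearMap (P.gen i) - g'.toLinearMap (P.gen i), -y (P.gen i)))
    (fun i => ⟨by simpa using sub_mem (g.map_mem _ _ (P.gen_mem i)) (g'.map_mem _ _ (P.gen_mem i)),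
      neg_mem (hy2 _ _ (P.gen_mem i))⟩) (fun i => by
      rw [coneDiff_apply, hy3', rightLift_prod, map_sub, d_hom_gen, d_hom_gen, ← rightLift_sub]
      ext
      · simp
      · simp [rightLift_neg])
  refine homotopic_of_gen (fun i => -(h i).1)
    (fun i => neg_mem (by simpa [sub_eq_add_neg, add_assoc] using (hdeg i).1)) fun i => ?_
  have h1 := congrArg Prod.fst (hd i)
  rw [rightLift_prod] at h1
  rw [rightLift_neg, map_neg]
  simpa [coneDiff] using h1

omit hw

/-- Morphisms in the homotopy category out of a semifree module do not see quasi-isomorphisms. -/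
lemma SemifreeData.bijective_comp_quasiIso {X Y : HomotopyCat A} (w : X ⟶ Y) (hw : quasiIso A w) :
    Function.Bijective fun g : (CategoryTheory.Quotient.functor _).obj P.toDGModule ⟶ X =>
      g ≫ w := by
  obtain ⟨X⟩ := X
  obtain ⟨Y⟩ := Y
  obtain ⟨w, rfl⟩ := (CategoryTheory.Quotient.functor (DGModule.homotopic A)).map_surjective w
  rw [quasiIso_functor_map_iff] at hw
  constructor
  · intro g g' h
    obtain ⟨g, rfl⟩ := (CategoryTheory.Quotient.functor (DGModule.homotopic A)).map_surjective g
    obtain ⟨g', rfl⟩ := (CategoryTheory.Quotient.functor (DGModule.homotopic A)).map_surjective g'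
    simp only [← Functor.map_comp] at h
    rw [CategoryTheory.Quotient.functor_map_eq_iff] at h ⊢
    exact P.homotopic_of_comp w hw h
  · intro f
    obtain ⟨f, rfl⟩ := (CategoryTheory.Quotient.functor (DGModule.homotopic A)).map_surjective f
    obtain ⟨g, hg⟩ := P.exists_lift w hw f
    refine ⟨(CategoryTheory.Quotient.functor _).map g, ?_⟩
    simp only [← Functor.map_comp]
    exact (CategoryTheory.Quotient.sound _ hg).symm

lemma SemifreeData.toDerivedCat_map_surjective (φ : (toDerivedCat A).obj P.toDGModule ⟶
    (toDerivedCat A).obj X) : ∃ f : P.toDGModule ⟶ X, (toDerivedCat A).map f = φ := by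
  obtain ⟨f, rfl⟩ := (bijective_Q_map (quasiIso A) _ (fun _ _ w hw => P.bijective_comp_quasiIso w hw) _).2 φ
  obtain ⟨f, rfl⟩ := (CategoryTheory.Quotient.functor (DGModule.homotopic A)).map_surjective f
  exact ⟨f, rfl⟩

lemma SemifreeData.toDerivedCat_map_eq_iff (f g : P.toDGModule ⟶ X) :
    (toDerivedCat A).map f = (toDerivedCat A).map g ↔ DGModule.homotopic A f g := by
  rw [← CategoryTheory.Quotient.functor_map_eq_iff (DGModule.homotopic A)]
  exact (bijective_Q_map (quasiIso A) _ (fun _ _ w hw => P.bijective_comp_quasiIso w hw) _).1.eq_iff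

end QuasiIso

/-! ### Coproducts of semifree modules -/

section MapDomain

variable {I J : Type u}

lemma rightLift_mapDomain {C : Type*} [AddCommGroup C] [Module k C] [Module A.carrierᵐᵒᵖ C]
    [IsScalarTower k A.carrierᵐᵒᵖ C] (f : I → J) (h : J → C) (x : I →₀ A.carrier) :
    rightLift (k := k) h (Finsupp.mapDomain f x) = rightLift (k := k) (fun i => h (f i)) x := by
  induction x using Finsupp.induction_linear with
  | zero => simp
  | add x y hx hy => rw [Finsupp.mapDomain_add, map_add, map_add, hx, hy]
  | single i a => simp

lemma coeffDiff_mapDomain (f : I → J) (deg : J → ℕ) (x : I →₀ A.carrier) :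
    coeffDiff deg (Finsupp.mapDomain f x) =
      Finsupp.mapDomain f (coeffDiff (fun i => deg (f i)) x) := by
  induction x using Finsupp.induction_linear with
  | zero => simp
  | add x y hx hy =>
    rw [Finsupp.mapDomain_add, map_add, map_add, hx, hy, Finsupp.mapDomain_add]
  | single i a =>
    rw [Finsupp.mapDomain_single, coeffDiff_single, coeffDiff_single]
    change _ = Finsupp.mapDomain.addMonoidHom f _
    rw [map_unit_smul]
    simp

lemma rightLift_single_one (f : I → J) (x : I →₀ A.carrier) :
    rightLift (k := k) (fun i => Finsupp.single (f i) (1 : A.carrier)) x =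
      Finsupp.mapDomain f x := by
  simp only [rightLift_apply, op_smul_single, one_mul]
  rfl

lemma rightLift_comp_mapDomain (f : I → J) (D : I → I →₀ A.carrier) (x : I →₀ A.carrier) :
    rightLift (k := k) (fun i => Finsupp.mapDomain f (D i)) x =
      Finsupp.mapDomain f (rightLift (k := k) D x) := by
  rw [← rightLift_single_one (k := k), rightLift_rightLift]
  simp only [rightLift_single_one]

lemma mapDomain_mem_semifreeGr (f : I → J) (deg : J → ℕ) {n : ℤ} {x : I →₀ A.carrier}
    (hx : x ∈ semifreeGr (fun i => deg (f i)) n) :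
    Finsupp.mapDomain f x ∈ semifreeGr deg n := by
  rw [← rightLift_single_one (k := k)]
  have := rightLift_mem _ (semifreeGr deg) (act_mem_semifreeGr deg) 0 hx
    (h := fun i => Finsupp.single (f i) 1) fun i _ => by
      simpa using single_one_mem_semifreeGr deg (f i)
  rwa [add_zero] at this

end MapDomain

namespace SemifreeData

section Sigma

variable {ι : Type u} (Y : ι → SemifreeData A)

/-- The differentials of the generators of a disjoint union. -/
abbrev sigmaD (i : Σ a, (Y a).I) : (Σ a, (Y a).I) →₀ A.carrier :=
  Finsupp.mapDomain (Sigma.mk i.1) ((Y i.1).D i.2)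

lemma semifreeDiff_sigma (a : ι) (x : (Y a).I →₀ A.carrier) :
    semifreeDiff (fun i : Σ a, (Y a).I => (Y i.1).deg i.2)
      (fun i => Finsupp.mapDomain (Sigma.mk i.1) ((Y i.1).D i.2))
      (Finsupp.mapDomain (Sigma.mk a) x) =
    Finsupp.mapDomain (Sigma.mk a) (semifreeDiff (Y a).deg (Y a).D x) := by
  have h := rightLift_mapDomain (k := k) (Sigma.mk a)
    (sigmaD Y) x
  have h' := rightLift_comp_mapDomain (k := k) (Sigma.mk a : _ → Σ a, (Y a).I) (Y a).D x
  rw [semifreeDiff_eq, h, coeffDiff_mapDomain, semifreeDiff_eq, Finsupp.mapDomain_add]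
  exact congrArg (· + _) h'

/-- The disjoint union of families of generators. -/
abbrev sigma : SemifreeData A where
  I := Σ a, (Y a).I
  deg i := (Y i.1).deg i.2
  D := sigmaD Y
  D_mem i := mapDomain_mem_semifreeGr (Sigma.mk i.1) (fun i : Σ a, (Y a).I => (Y i.1).deg i.2)
    ((Y i.1).D_mem i.2)
  D_lt i j h := by
    classical
    obtain ⟨l, hl, rfl⟩ := Finset.mem_image.1
      (Finsupp.mapDomain_support (Finsupp.mem_support_iff.2 h))
    exact (Y i.1).D_lt i.2 l (Finsupp.mem_support_iff.1 hl)
  d_D i := by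
    rw [semifreeDiff_sigma, d_D, Finsupp.mapDomain_zero]

/-- The inclusion of a summand. -/
def sigmaInj (a : ι) : (Y a).toDGModule ⟶ (sigma Y).toDGModule :=
  homMk _ (fun i => (sigma Y).gen ⟨a, i⟩) (fun i => (sigma Y).gen_mem ⟨a, i⟩) fun i =>
    ((sigma Y).d_gen ⟨a, i⟩).trans
      (rightLift_single_one (k := k) (fun i : (Y a).I => (⟨a, i⟩ : Σ a, (Y a).I)) _).symm

@[simp]
lemma sigmaInj_gen (a : ι) (i : (Y a).I) :
    (sigmaInj Y a).toLinearMap ((Y a).gen i) = (sigma Y).gen ⟨a, i⟩ :=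
  homMk_gen _ _ _ _ _

variable {Y} {Z : DGModule A}

/-- The morphism out of a coproduct given by its components. -/
def sigmaDesc (g : ∀ a, (Y a).toDGModule ⟶ Z) : (sigma Y).toDGModule ⟶ Z :=
  homMk _ (fun i => (g i.1).toLinearMap ((Y i.1).gen i.2))
    (fun i => (g i.1).map_mem _ _ ((Y i.1).gen_mem i.2)) fun i => by
      rw [d_hom_gen]
      exact (rightLift_mapDomain (k := k) (Sigma.mk i.1)
        (fun i : Σ a, (Y a).I => (g i.1).toLinearMap ((Y i.1).gen i.2)) ((Y i.1).D i.2)).symm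

lemma sigmaDesc_gen (g : ∀ a, (Y a).toDGModule ⟶ Z) (i : (sigma Y).I) :
    (sigmaDesc g).toLinearMap ((sigma Y).gen i) = (g i.1).toLinearMap ((Y i.1).gen i.2) :=
  homMk_gen _ _ _ _ _

lemma sigmaInj_desc (g : ∀ a, (Y a).toDGModule ⟶ Z) (a : ι) : sigmaInj Y a ≫ sigmaDesc g = g a :=
  hom_ext fun i => by
    rw [DGModule.comp_toLinearMap, LinearMap.comp_apply, sigmaInj_gen, sigmaDesc_gen]

/-- Homotopies chosen separately on the summands are glued through their values on generators. -/
lemma homotopic_of_sigmaInj {f g : (sigma Y).toDGModule ⟶ Z}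
    (h : ∀ a, DGModule.homotopic A (sigmaInj Y a ≫ f) (sigmaInj Y a ≫ g)) :
    DGModule.homotopic A f g := by
  choose h h1 h2 h3 using h
  refine homotopic_of_gen (fun i => h i.1 ((Y i.1).gen i.2))
    (fun i => h2 _ _ _ ((Y i.1).gen_mem i.2)) fun i => ?_
  have := h3 i.1 ((Y i.1).gen i.2)
  rw [d_gen, DGModule.comp_toLinearMap, DGModule.comp_toLinearMap, LinearMap.comp_apply,
    LinearMap.comp_apply, sigmaInj_gen] at this
  refine this.trans (congrArg _ ?_)
  exact (LinearMap.congr_fun (eq_rightLift (I := (Y i.1).I) (f := h i.1) (h1 i.1)) _).trans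
    (rightLift_mapDomain (Sigma.mk i.1)
      (fun i : Σ a, (Y a).I => h i.1 ((Y i.1).gen i.2)) ((Y i.1).D i.2)).symm

variable (Y)

/-- The coproduct of semifree modules as a cofan in the derived category. -/
abbrev sigmaCofan : Cofan fun a => (toDerivedCat A).obj (Y a).toDGModule :=
  Cofan.mk ((toDerivedCat A).obj (sigma Y).toDGModule) fun a => (toDerivedCat A).map (sigmaInj Y a)

/-- Existence of the induced morphism comes from `C(A)` by representing each component; uniqueness
is the gluing of homotopies. -/
lemma nonempty_isColimit_sigmaCofan : Nonempty (IsColimit (sigmaCofan Y)) := by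
  have key (Z : DerivedCat A) (φ : ∀ a, (toDerivedCat A).obj (Y a).toDGModule ⟶ Z) :
      ∃ ψ : (toDerivedCat A).obj (sigma Y).toDGModule ⟶ Z,
        (∀ a, (toDerivedCat A).map (sigmaInj Y a) ≫ ψ = φ a) ∧
        ∀ ψ', (∀ a, (toDerivedCat A).map (sigmaInj Y a) ≫ ψ' = φ a) → ψ' = ψ := by
    -- Every object of the derived category is the image of a differential graded module.
    obtain ⟨⟨⟨Z⟩⟩⟩ := Z
    choose g hg using fun a => (Y a).toDerivedCat_map_surjective (X := Z) (φ a)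
    refine ⟨(toDerivedCat A).map (sigmaDesc g), fun a => ?_, fun ψ' hψ' => ?_⟩
    · exact ((toDerivedCat A).map_comp _ _).symm.trans
        ((congrArg _ (sigmaInj_desc g a)).trans (hg a))
    · obtain ⟨f, rfl⟩ := (sigma Y).toDerivedCat_map_surjective (X := Z) ψ'
      refine (toDerivedCat_map_eq_iff _ _ _).2 (homotopic_of_sigmaInj fun a => ?_)
      rw [← toDerivedCat_map_eq_iff, sigmaInj_desc]
      exact ((toDerivedCat A).map_comp _ _).trans ((hψ' a).trans (hg a).symm)
  choose ψ h1 h2 using key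
  exact ⟨Cofan.IsColimit.mk _ (fun s => ψ s.pt s.inj) (fun s a => h1 s.pt s.inj a)
    fun s m hm => h2 s.pt s.inj m hm⟩

end Sigma

/-! ### Truncation of the generators -/

section Trunc

variable (P : SemifreeData A)

-- The differential lowers the degrees of generators, so those of degree at most `n` span a
-- submodule, and the quotient by it inherits the differential.
open Classical in
lemma rightLift_subtypeDomain (n : ℕ) (x : P.I →₀ A.carrier) :
    (rightLift (k := k) P.D x).subtypeDomain (fun i => n < P.deg i) =
      rightLift (k := k) (fun i : {i // n < P.deg i} => (P.D i).subtypeDomain fun i => n < P.deg i)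
        (x.subtypeDomain fun i => n < P.deg i) := by
  induction x using Finsupp.induction_linear with
  | zero => simp
  | add x y hx hy =>
    rw [map_add, Finsupp.subtypeDomain_add, hx, hy, Finsupp.subtypeDomain_add, map_add]
  | single i a =>
    by_cases hi : n < P.deg i
    · have e : (Finsupp.single i a).subtypeDomain (fun i => n < P.deg i) =
          Finsupp.single ⟨i, hi⟩ a := by
        ext j
        simp [Finsupp.single_apply, Subtype.ext_iff]
      rw [e, rightLift_single, rightLift_single]
      ext j
      simp
    · have e : (Finsupp.single i a).subtypeDomain (fun i => n < P.deg i) = 0 := by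
        ext ⟨j, hj⟩
        have : i ≠ j := by rintro rfl; exact hi hj
        simp [this]
      rw [e, rightLift_single, map_zero]
      ext ⟨j, hj⟩
      have : P.D i j = 0 := by
        by_contra h
        exact hi (hj.trans (P.D_lt i j h))
      simp [this]

lemma semifreeDiff_subtypeDomain (n : ℕ) (x : P.I →₀ A.carrier) :
    (semifreeDiff P.deg P.D x).subtypeDomain (fun i => n < P.deg i) =
      semifreeDiff (fun i : {i // n < P.deg i} => P.deg i)
        (fun i : {i // n < P.deg i} => (P.D i).subtypeDomain fun i => n < P.deg i)
        (x.subtypeDomain fun i => n < P.deg i) := by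
  rw [semifreeDiff_eq, Finsupp.subtypeDomain_add, rightLift_subtypeDomain, semifreeDiff_eq]
  congr 1
  ext i
  simp

lemma subtypeDomain_mem_semifreeGr (n : ℕ) {m : ℤ} {x : P.I →₀ A.carrier}
    (hx : x ∈ semifreeGr P.deg m) : x.subtypeDomain (fun i => n < P.deg i) ∈
      semifreeGr (fun i : {i // n < P.deg i} => P.deg i) m :=
  mem_semifreeGr.2 fun i => mem_semifreeGr.1 hx i

/-- The generators of degree greater than `n`. -/
abbrev trunc (n : ℕ) : SemifreeData A where
  I := {i // n < P.deg i}
  deg i := P.deg i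
  D i := (P.D i).subtypeDomain fun i => n < P.deg i
  D_mem i := P.subtypeDomain_mem_semifreeGr n (P.D_mem i)
  D_lt i j h := P.D_lt i j h
  d_D i := by
    rw [← semifreeDiff_subtypeDomain, P.d_D]
    rfl

/-- The projection onto the generators of degree greater than `n`. -/
def toTrunc (n : ℕ) : P.toDGModule ⟶ (P.trunc n).toDGModule where
  toLinearMap := Finsupp.lsubtypeDomain fun i => n < P.deg i
  map_act _ _ := Finsupp.ext fun _ => rfl
  map_mem _ _ hx := P.subtypeDomain_mem_semifreeGr n hx
  map_d x := P.semifreeDiff_subtypeDomain n x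

lemma toTrunc_apply (n : ℕ) (x : P.I →₀ A.carrier) (j : {i // n < P.deg i}) :
    ((P.toTrunc n).toLinearMap x : {i // n < P.deg i} →₀ A.carrier) j = x j := rfl

lemma toTrunc_gen_eq_zero {n : ℕ} {i : P.I} (h : P.deg i ≤ n) :
    (P.toTrunc n).toLinearMap (P.gen i) = 0 := by
  refine Finsupp.ext fun j => ?_
  have hj : i ≠ j.1 := fun e => by
    have := j.2
    rw [← e] at this
    omega
  refine (P.toTrunc_apply n (P.gen i) j).trans ?_
  exact Finsupp.single_eq_of_ne hj.symm

end Trunc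

/-! ### Minimality -/

section Minimal

variable (P : SemifreeData A) (ε : A.Augmentation)

/-- Minimality: a nonzero `D i j` has degree `deg i + 1 - deg j ≥ 2`. -/
lemma augmentation_D (i j : P.I) : ε.toAlgHom (P.D i j) = 0 := by
  by_cases h : P.D i j = 0
  · rw [h, map_zero]
  · have := P.D_lt i j h
    exact ε.map_of_ne_zero _ _ (by omega) (mem_semifreeGr.1 (P.D_mem i) j)

lemma augmentation_d (x : P.I →₀ A.carrier) (i : P.I) :
    ε.toAlgHom (semifreeDiff P.deg P.D x i) = 0 := by
  induction x using Finsupp.induction_linear with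
  | zero => simp
  | add x y hx hy => rw [map_add, Finsupp.add_apply, map_add, hx, hy, add_zero]
  | single j a =>
    classical
    rw [semifreeDiff_single, Finsupp.add_apply, map_add, Finsupp.smul_apply, op_smul_eq_mul,
      map_mul, augmentation_D, zero_mul, zero_add, Finsupp.smul_apply, map_unit_smul,
      Finsupp.single_apply]
    split_ifs <;> simp [ε.map_d]

instance {M N : DGModule A} : Zero (M ⟶ N) :=
  ⟨{ toLinearMap := 0
     map_act := by simp
     map_mem := fun _ _ _ => zero_mem _
     map_d := by simp }⟩

lemma zero_toLinearMap (M N : DGModule A) : DGModule.Hom.toLinearMap (0 : M ⟶ N) = 0 := rfl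

lemma comp_zero_hom {M N Q : DGModule A} (f : M ⟶ N) : f ≫ (0 : N ⟶ Q) = 0 := by
  refine DGModule.Hom.ext (LinearMap.ext fun x => ?_)
  simp [zero_toLinearMap]

include ε in
/-- A semifree module is minimal, so the projection onto its generators of large degree is
essential. -/
lemma not_homotopic_toTrunc_zero {n : ℕ} {i : P.I} (hi : n < P.deg i) :
    ¬ DGModule.homotopic A (P.toTrunc n) 0 := by
  rintro ⟨h, h1, -, h3⟩
  have e := h3 (P.gen i)
  rw [zero_toLinearMap, LinearMap.zero_apply, sub_zero, d_gen] at e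
  -- Apply `ε` to the coefficient of `e i`. The left side is `1`. On the right, `ε` kills the
  -- coefficients of any differential, and `h (D i) = Σ h (e j) * D i j` has coefficients that are
  -- multiples of the `D i j`.
  have e' : ε.toAlgHom (Finsupp.single i (1 : A.carrier) i) =
      ε.toAlgHom (semifreeDiff (P.trunc n).deg (P.trunc n).D (h (P.gen i)) ⟨i, hi⟩ +
        (h (P.D i) : (P.trunc n).I →₀ A.carrier) ⟨i, hi⟩) :=
    congrArg (fun x : (P.trunc n).I →₀ A.carrier => ε.toAlgHom (x ⟨i, hi⟩)) e
  have e2 : h (P.D i) = (P.D i).sum fun j a => op a • h (P.gen j) :=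
    LinearMap.congr_fun (eq_rightLift (I := P.I) (f := h) h1) (P.D i)
  rw [map_add, augmentation_d, zero_add, e2, Finsupp.sum, Finsupp.finsetSum_apply, map_sum,
    Finset.sum_eq_zero, Finsupp.single_eq_same, map_one] at e'
  · exact one_ne_zero e'
  · intro j _
    rw [Finsupp.smul_apply, op_smul_eq_mul, map_mul, augmentation_D, mul_zero]

end Minimal

/-! ### Semifree modules with generators of unbounded degree are not compact -/

section NotCompact

variable (P : SemifreeData A)

/-- All the truncations of a family of generators. -/
abbrev truncs : ULift.{u} ℕ → SemifreeData A := fun n => P.trunc n.down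

/-- The sum of the first projections, followed by the inclusions into the coproduct. -/
def partialDiag (N : ℕ) : P.toDGModule.carrier →ₗ[k] (sigma P.truncs).toDGModule.carrier :=
  ∑ n ∈ Finset.range N,
    (DGModule.Hom.toLinearMap (P.toTrunc n ≫ sigmaInj P.truncs ⟨n⟩))

lemma partialDiag_act (N : ℕ) (x : P.toDGModule.carrier) (a : A.carrier) :
    P.partialDiag N (op a • x) = op a • P.partialDiag N x := by
  simp only [partialDiag, LinearMap.sum_apply, Finset.smul_sum]
  exact Finset.sum_congr rfl fun n _ =>
    DGModule.Hom.map_act (P.toTrunc n ≫ sigmaInj P.truncs ⟨n⟩) _ _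

/-- The projections with `n ≥ deg i` kill `e i`, so the partial sums stabilise on each generator and
the infinite sum makes sense. -/
lemma partialDiag_gen {i : P.I} {N : ℕ} (h : P.deg i ≤ N) :
    P.partialDiag N (P.gen i) = P.partialDiag (P.deg i) (P.gen i) := by
  simp only [partialDiag, LinearMap.sum_apply]
  symm
  refine Finset.sum_subset (Finset.range_mono h) fun n _ hn => ?_
  rw [DGModule.comp_toLinearMap, LinearMap.comp_apply,
    toTrunc_gen_eq_zero P (by simpa using hn), map_zero]

/-- The morphism to the coproduct of all the truncations with components the projections. -/
def diag : P.toDGModule ⟶ (sigma P.truncs).toDGModule :=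
  P.homMk (fun i => P.partialDiag (P.deg i) (P.gen i))
    (fun i => by
      simp only [partialDiag, LinearMap.sum_apply]
      exact sum_mem fun n _ => DGModule.Hom.map_mem
        (P.toTrunc n ≫ sigmaInj P.truncs ⟨n⟩) _ _ (P.gen_mem i))
    fun i => by
      -- All generators in `D i` have degree below `deg i`, so one partial sum serves for all of
      -- them.
      have e : rightLift (k := k) (fun j => P.partialDiag (P.deg j) (P.gen j)) (P.D i) =
          P.partialDiag (P.deg i) (P.D i) :=
        (rightLift_congr fun j hj => (P.partialDiag_gen (P.D_lt i j hj).le).symm).trans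
          (LinearMap.congr_fun (eq_rightLift (I := P.I) (f := P.partialDiag (P.deg i))
            (P.partialDiag_act _)) (P.D i)).symm
      rw [e, ← d_gen]
      simp only [partialDiag, LinearMap.sum_apply, map_sum]
      exact Finset.sum_congr rfl fun n _ => (DGModule.Hom.map_d
        (P.toTrunc n ≫ sigmaInj P.truncs ⟨n⟩) _).symm

open Classical in
/-- The projection from the coproduct onto one of its summands. -/
def sigmaProj (n : ℕ) : (sigma P.truncs).toDGModule ⟶ (P.trunc n).toDGModule :=
  sigmaDesc fun m => if h : m.down = n then eqToHom (by rw [truncs, h]) else 0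

lemma sigmaInj_proj_self (n : ℕ) : sigmaInj P.truncs ⟨n⟩ ≫ P.sigmaProj n = 𝟙 _ := by
  rw [sigmaProj, sigmaInj_desc, dif_pos rfl]
  rfl

lemma sigmaInj_proj_of_ne {n : ℕ} {m : ULift.{u} ℕ} (h : m ≠ ⟨n⟩) :
    sigmaInj P.truncs m ≫ P.sigmaProj n = 0 := by
  rw [sigmaProj, sigmaInj_desc, dif_neg]
  rintro rfl
  exact h rfl

lemma diag_proj (n : ℕ) : P.diag ≫ P.sigmaProj n = P.toTrunc n := by
  refine hom_ext fun i => ?_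
  rw [DGModule.comp_toLinearMap, LinearMap.comp_apply, diag, homMk_gen, partialDiag,
    LinearMap.sum_apply, map_sum]
  have h (m : ℕ) : (P.sigmaProj n).toLinearMap ((P.toTrunc m ≫ sigmaInj P.truncs ⟨m⟩).toLinearMap
      (P.gen i)) = if m = n then (P.toTrunc n).toLinearMap (P.gen i) else 0 := by
    rw [← LinearMap.comp_apply, ← DGModule.comp_toLinearMap, Category.assoc]
    split_ifs with hm
    · subst hm
      rw [sigmaInj_proj_self, Category.comp_id]
    · rw [sigmaInj_proj_of_ne, comp_zero_hom]
      · rfl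
      · exact fun e => hm (congrArg ULift.down e)
  rw [Finset.sum_congr rfl fun m _ => h m, Finset.sum_ite_eq']
  split_ifs with hn
  · rfl
  · exact (P.toTrunc_gen_eq_zero (by simpa using hn)).symm

theorem not_isCompactObject (ε : A.Augmentation) (hP : ∀ n : ℕ, ∃ i, n < P.deg i) :
    ¬ IsCompactObject.{u} ((toDerivedCat A).obj P.toDGModule) := by
  intro H
  obtain ⟨hc⟩ := nonempty_isColimit_sigmaCofan P.truncs
  obtain ⟨s, c', hc', g, hg⟩ := H _ _ _ hc ((toDerivedCat A).map P.diag)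
  obtain ⟨n, hn⟩ : ∃ n : ℕ, (⟨n⟩ : ULift.{u} ℕ) ∉ s := by
    obtain ⟨⟨n⟩, hn⟩ := Infinite.exists_notMem_finset s
    exact ⟨n, hn⟩
  obtain ⟨i, hi⟩ := hP n
  refine P.not_homotopic_toTrunc_zero ε hi ?_
  -- Both sides are written as composites with `diag`, which factors through the summands indexed by
  -- `s`. As `n ∉ s`, the projection to the summand `n` vanishes on each of these.
  rw [← toDerivedCat_map_eq_iff, ← diag_proj, ← comp_zero_hom P.diag, Functor.map_comp,
    Functor.map_comp, ← hg]
  refine (Category.assoc _ _ _).trans (Eq.trans ?_ (Category.assoc _ _ _).symm)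
  congr 1
  refine Cofan.IsColimit.hom_ext hc' _ _ fun m => ?_
  rw [Cofan.IsColimit.fac_assoc, Cofan.IsColimit.fac_assoc]
  change (toDerivedCat A).map (sigmaInj P.truncs m.1) ≫ _ =
    (toDerivedCat A).map (sigmaInj P.truncs m.1) ≫ _
  rw [← Functor.map_comp, ← Functor.map_comp, sigmaInj_proj_of_ne, comp_zero_hom]
  rintro h
  exact hn (h ▸ m.2)

end NotCompact

end SemifreeData

lemma IsCompactObject.of_iso {C : Type v} [Category.{u} C] {X Y : C} (e : X ≅ Y)
    (h : IsCompactObject.{w} X) : IsCompactObject.{w} Y := by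
  intro ι Z c hc f
  obtain ⟨s, c', hc', g, hg⟩ := h ι Z c hc (e.hom ≫ f)
  exact ⟨s, c', hc', e.inv ≫ g, by rw [Category.assoc, hg, e.inv_hom_id_assoc]⟩

/-! ### Simply connected algebras -/

namespace DGAlgebra

lemma exists_primitive_of_mk_eq_zero {n : ℤ} {a : A.carrier} (ha : a ∈ A.gr n) (hda : A.d a = 0)
    (h : (Submodule.Quotient.mk ⟨a, ha, hda⟩ : A.H n) = 0) : ∃ b ∈ A.gr (n - 1), A.d b = a :=
  (Submodule.Quotient.mk_eq_zero _).1 h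

lemma exists_primitive_of_subsingleton {n : ℤ} (hn : Subsingleton (A.H n)) {a : A.carrier}
    (ha : a ∈ A.gr n) (hda : A.d a = 0) : ∃ b ∈ A.gr (n - 1), A.d b = a :=
  exists_primitive_of_mk_eq_zero ha hda (Subsingleton.elim _ _)

namespace IsSimplyConnectedOfFiniteType

variable (hA : A.IsSimplyConnectedOfFiniteType)
include hA

lemma eq_zero_of_neg {n : ℤ} (hn : n < 0) {a : A.carrier} (ha : a ∈ A.gr n) : a = 0 := by
  rw [hA.positively_graded n hn] at ha
  exact (Submodule.mem_bot k).1 ha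

/-- Since `A` is zero in degree `-1`, cocycles of degree `0` inject into `H⁰ A ≅ k`, which is
spanned by the nonzero class of `1`. The scalar is read off by `ε`. -/
lemma eq_algebraMap (ε : A.Augmentation) {a : A.carrier} (ha : a ∈ A.gr 0) (hda : A.d a = 0) :
    a = ε.toAlgHom a • 1 := by
  obtain ⟨e⟩ := hA.H_zero
  have zero_of {b : A.carrier} (hb : b ∈ A.gr 0) (hdb : A.d b = 0)
      (h : (Submodule.Quotient.mk ⟨b, hb, hdb⟩ : A.H 0) = 0) : b = 0 := by
    obtain ⟨c, hc, rfl⟩ := exists_primitive_of_mk_eq_zero hb hdb h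
    rw [hA.eq_zero_of_neg (by norm_num) hc, map_zero]
  have h1 : (Submodule.Quotient.mk ⟨1, A.one_mem, A.d_one⟩ : A.H 0) ≠ 0 := fun h => by
    have := congrArg ε.toAlgHom (zero_of A.one_mem A.d_one h)
    simp at this
  obtain ⟨c, hc⟩ := exists_smul_eq_of_finrank_eq_one
    (e.finrank_eq.trans (Module.finrank_self k)) h1 (Submodule.Quotient.mk ⟨a, ha, hda⟩)
  have hac : a - c • 1 = 0 := by
    refine zero_of (sub_mem ha (Submodule.smul_mem _ c A.one_mem))
      (by rw [map_sub, hda, map_smul, A.d_one, smul_zero, sub_zero]) ?_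
    rw [← sub_eq_zero] at hc
    rw [← neg_eq_zero, ← hc, ← Submodule.Quotient.mk_smul, ← Submodule.Quotient.mk_sub,
      ← Submodule.Quotient.mk_neg]
    congr 1
    ext
    simp
  rw [sub_eq_zero] at hac
  rw [hac]
  simp

/-- The cohomology has a top degree, which is positive if there is more than `H⁰`. -/
lemma exists_top_degree (hdim : 2 ≤ Module.finrank k A.TotalH) :
    ∃ s : ℤ, 1 ≤ s ∧ (∃ a ∈ A.gr s, A.d a = 0 ∧ ∀ b ∈ A.gr (s - 1), A.d b ≠ a) ∧
      ∀ n, s < n → ∀ a ∈ A.gr n, A.d a = 0 → ∃ b ∈ A.gr (n - 1), A.d b = a := by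
  classical
  have hfin := hA.finite
  -- Finitely many generators of `H* A` have components in only finitely many degrees.
  obtain ⟨N, hN⟩ : ∃ N : ℤ, ∀ n, N < n → Subsingleton (A.H n) := by
    obtain ⟨S, hS⟩ := hfin.fg_top
    obtain ⟨N, hN⟩ := ((S.biUnion fun x => DFinsupp.support x).bddAbove)
    refine ⟨N, fun n hn => ⟨fun x y => ?_⟩⟩
    have hzero (z : A.TotalH) : z n = 0 := by
      have : z ∈ LinearMap.ker (DirectSum.component k ℤ (fun n => A.H n) n) := by
        have h : (⊤ : Submodule k A.TotalH) ≤
            LinearMap.ker (DirectSum.component k ℤ (fun n => A.H n) n) := by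
          rw [← hS, Submodule.span_le]
          intro z hz
          by_contra h
          have : n ≤ N := hN (Finset.mem_coe.2 (Finset.mem_biUnion.2
            ⟨z, hz, DFinsupp.mem_support_iff.2 h⟩))
          omega
        exact h trivial
      exact this
    have hx := hzero (DirectSum.lof k ℤ (fun n => A.H n) n x)
    have hy := hzero (DirectSum.lof k ℤ (fun n => A.H n) n y)
    rw [DirectSum.lof_apply] at hx hy
    rw [hx, hy]
  -- Otherwise `H* A` would be a quotient of the one-dimensional `H⁰ A`.
  obtain ⟨t, ht1, ht⟩ : ∃ t : ℤ, 1 ≤ t ∧ ¬ Subsingleton (A.H t) := by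
    by_contra! H
    obtain ⟨e⟩ := hA.H_zero
    have hsurj : Function.Surjective (DirectSum.lof k ℤ (fun n => A.H n) 0) := by
      intro z
      refine ⟨z 0, ?_⟩
      refine DFinsupp.ext fun n => ?_
      rcases eq_or_ne n 0 with rfl | hn
      · rw [DirectSum.lof_apply]
      · have : Subsingleton (A.H n) := by
          rcases lt_or_gt_of_ne hn with h | h
          · refine ⟨fun x y => ?_⟩
            obtain ⟨⟨x, hx⟩, rfl⟩ := Submodule.Quotient.mk_surjective _ x
            obtain ⟨⟨y, hy⟩, rfl⟩ := Submodule.Quotient.mk_surjective _ y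
            obtain rfl := hA.eq_zero_of_neg h hx.1
            obtain rfl := hA.eq_zero_of_neg h hy.1
            rfl
          · exact H n (by omega)
        exact Subsingleton.elim _ _
    have : Module.Finite k (A.H 0) := Module.Finite.equiv e.symm
    have h := LinearMap.finrank_le_finrank_of_surjective hsurj
    rw [e.finrank_eq, Module.finrank_self] at h
    exact absurd (hdim.trans h) (by norm_num)
  obtain ⟨s, hs, hmax⟩ := Int.exists_greatest_of_bdd (P := fun n => ¬ Subsingleton (A.H n))
    ⟨N, fun n hn => not_lt.1 fun h => hn (hN n h)⟩ ⟨t, ht⟩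
  refine ⟨s, ht1.trans (hmax t ht), ?_, fun n hn a ha hda => exists_primitive_of_subsingleton
    (not_not.1 fun h => absurd (hmax n h) (not_le.2 hn)) ha hda⟩
  by_contra! H
  refine hs ⟨fun x y => ?_⟩
  have hzero (z : A.H s) : z = 0 := by
    obtain ⟨⟨z, hz⟩, rfl⟩ := Submodule.Quotient.mk_surjective _ z
    exact (Submodule.Quotient.mk_eq_zero _).2 (H z hz.1 hz.2)
  rw [hzero x, hzero y]

end IsSimplyConnectedOfFiniteType

end DGAlgebra

/-! ### Coefficients of the differential -/

section Coefficients

variable {I : Type u} (deg : I → ℕ) (D : I → I →₀ A.carrier)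

lemma rightLift_coeff_eq_zero {x : I →₀ A.carrier} {i : I} (h : ∀ l, x l ≠ 0 → D l i = 0) :
    rightLift (k := k) D x i = 0 := by
  rw [rightLift_apply, Finsupp.sum, Finsupp.finsetSum_apply]
  refine Finset.sum_eq_zero fun l hl => ?_
  rw [Finsupp.smul_apply, h l (Finsupp.mem_support_iff.1 hl), smul_zero]

/-- Typically used when `i` has maximal degree among the generators in play: no other generator
contributes to its coefficient. -/
lemma semifreeDiff_coeff {x : I →₀ A.carrier} {i : I} (h : ∀ l, x l ≠ 0 → D l i = 0) :
    semifreeDiff deg D x i = (deg i : ℤ).negOnePow • A.d (x i) := by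
  rw [semifreeDiff_eq, Finsupp.add_apply, rightLift_coeff_eq_zero D h, zero_add, coeffDiff_apply]

lemma d_coeff_eq_zero {x : I →₀ A.carrier} {i : I} (h : ∀ l, x l ≠ 0 → D l i = 0)
    (hx : semifreeDiff deg D x = 0) : A.d (x i) = 0 := by
  have := semifreeDiff_coeff deg D h
  rw [hx, Finsupp.zero_apply] at this
  rw [← unit_smul_smul_self (deg i : ℤ).negOnePow (A.d (x i)), ← this, smul_zero]

/-- A set of supports closed under the differentials of its generators is preserved by the
differential. -/
lemma semifreeDiff_support {T : Set I} (hT : ∀ j ∈ T, ∀ i, D j i ≠ 0 → i ∈ T) {x : I →₀ A.carrier}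
    (hx : ∀ i, x i ≠ 0 → i ∈ T) : ∀ i, semifreeDiff deg D x i ≠ 0 → i ∈ T := by
  intro i hi
  by_contra hiT
  refine hi ?_
  rw [semifreeDiff_coeff deg D fun l hl => not_not.1 fun h => hiT (hT l (hx l hl) i h)]
  rw [not_not.1 fun h => hiT (hx i h), map_zero, smul_zero]

/-- Coefficients that are coboundaries can be removed simultaneously. -/
lemma exists_kill_coeff {N : Set I} (hN : ∀ l ∈ N, ∀ i ∈ N, D l i = 0) {n : ℤ}
    {x : I →₀ A.carrier} (hb : ∀ i ∈ N, ∃ b ∈ A.gr (n - 1 - deg i), A.d b = x i) :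
    ∃ u ∈ semifreeGr deg (n - 1), (∀ i, u i ≠ 0 → i ∈ N ∧ x i ≠ 0) ∧
      ∀ i ∈ N, semifreeDiff deg D u i = x i := by
  classical
  choose! b hb hdb using hb
  let u : I →₀ A.carrier := Finsupp.onFinset x.support
    (fun i => if i ∈ N ∧ x i ≠ 0 then (deg i : ℤ).negOnePow • b i else 0) fun i hi => by
      by_contra h
      simp at h
      simp [h] at hi
  have hu (i : I) : u i = if i ∈ N ∧ x i ≠ 0 then (deg i : ℤ).negOnePow • b i else 0 := rfl
  have husupp (i : I) (hi : u i ≠ 0) : i ∈ N ∧ x i ≠ 0 := by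
    by_contra h
    rw [hu, if_neg h] at hi
    exact hi rfl
  refine ⟨u, mem_semifreeGr.2 fun i => ?_, husupp, fun i hi => ?_⟩
  · rw [hu]
    split_ifs with h
    · exact unit_smul_mem _ _ (hb i h.1)
    · exact zero_mem _
  · rw [semifreeDiff_coeff deg D fun l hl => hN l (husupp l hl).1 i hi, hu]
    split_ifs with h
    · rw [map_unit_smul, unit_smul_smul_self, hdb i hi]
    · rw [map_zero, smul_zero, not_not.1 fun hx => h ⟨hi, hx⟩]

end Coefficients

/-! ### Generators of unbounded degree -/

namespace SemifreeData

variable (P : SemifreeData A) {s : ℤ}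

/-- If the cohomology of `A` vanishes above degree `s`, then a cocycle of large degree in the part
generated in degrees smaller than `r` is a coboundary there. -/
lemma exists_primitive_of_deg_lt
    (hs : ∀ n, s < n → ∀ a ∈ A.gr n, A.d a = 0 → ∃ b ∈ A.gr (n - 1), A.d b = a) (r : ℕ) :
    ∀ (n : ℤ) (x : P.I →₀ A.carrier), s + r ≤ n → x ∈ semifreeGr P.deg n →
      semifreeDiff P.deg P.D x = 0 → (∀ i, x i ≠ 0 → P.deg i < r) →
      ∃ y ∈ semifreeGr P.deg (n - 1), semifreeDiff P.deg P.D y = x ∧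
        ∀ i, y i ≠ 0 → P.deg i < r := by
  induction r with
  | zero =>
    intro n x _ _ _ hx
    have : x = 0 := Finsupp.ext fun i => not_not.1 fun h => absurd (hx i h) (Nat.not_lt_zero _)
    exact ⟨0, zero_mem _, by rw [map_zero, this], by simp⟩
  | succ r ih =>
    intro n x hn hx hdx hsupp
    -- The coefficients of `x` at generators of degree `r` are cocycles of degree `n - r > s`, hence
    -- coboundaries. Subtracting `d u` removes them and leaves only generators of degree below `r`.
    obtain ⟨u, hu, husupp, hdu⟩ := exists_kill_coeff (n := n) (x := x) P.deg P.D
      (N := {i | P.deg i = r})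
      (fun l hl i hi => by
        by_contra h
        have := P.D_lt l i h
        rw [hl, hi] at this
        exact lt_irrefl _ this)
      (fun i hi => by
        have hd : A.d (x i) = 0 := by
          refine d_coeff_eq_zero P.deg P.D (fun l hl => ?_) hdx
          by_contra h
          have h1 := P.D_lt l i h
          have h2 := hsupp l hl
          rw [hi] at h1
          omega
        have := hs _ (by rw [hi]; push_cast at hn; omega) _ (mem_semifreeGr.1 hx i) hd
        rwa [show n - P.deg i - 1 = n - 1 - P.deg i by ring] at this)
    have hdu_mem : semifreeDiff P.deg P.D u ∈ semifreeGr P.deg n := by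
      have := semifreeDiff_mem hu fun i _ => P.D_mem i
      rwa [sub_add_cancel] at this
    obtain ⟨y, hy, hdy, hysupp⟩ := ih n (x - semifreeDiff P.deg P.D u)
      (by push_cast at hn; omega) (sub_mem hx hdu_mem)
      (by rw [map_sub, hdx, semifreeDiff_semifreeDiff (fun i _ => P.D_mem i) fun i _ => P.d_D i,
        sub_zero]) (fun i hi => by
        have h1 : P.deg i ∈ Set.Iic r := by
          by_contra h
          rw [Set.mem_Iic] at h
          refine hi ?_
          have h2 : semifreeDiff P.deg P.D u i = 0 := by
            by_contra h3
            exact h (semifreeDiff_support P.deg P.D (T := {i | P.deg i ≤ r})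
              (fun j hj i hi => (P.D_lt j i hi).le.trans hj)
              (fun i hi => (husupp i hi).1.le) i h3)
          have h3 : x i = 0 := by
            by_contra h3
            have := hsupp i h3
            omega
          rw [Finsupp.sub_apply, h2, h3, sub_zero]
        rcases (Set.mem_Iic.1 h1).lt_or_eq with h | h
        · exact h
        · rw [Finsupp.sub_apply, hdu i h, sub_self] at hi
          exact absurd rfl hi)
    refine ⟨y + u, add_mem hy hu, by rw [map_add, hdy, sub_add_cancel], fun i hi => ?_⟩
    by_cases h : y i = 0
    · rw [Finsupp.add_apply, h, zero_add] at hi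
      have : P.deg i = r := (husupp i hi).1
      omega
    · exact (hysupp i h).trans (Nat.lt_succ_self r)

/-- If the cohomology of `A` has a positive top degree and the cohomology of a nonzero semifree
module vanishes in positive degrees, then its generators have unbounded degree. -/
lemma exists_deg_gt [Nonempty P.I] (hs1 : 1 ≤ s)
    (hs2 : ∃ a ∈ A.gr s, A.d a = 0 ∧ ∀ b ∈ A.gr (s - 1), A.d b ≠ a)
    (hs : ∀ n, s < n → ∀ a ∈ A.gr n, A.d a = 0 → ∃ b ∈ A.gr (n - 1), A.d b = a)
    (hP : ∀ n : ℤ, 1 ≤ n → ∀ x ∈ semifreeGr P.deg n, semifreeDiff P.deg P.D x = 0 →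
      ∃ y ∈ semifreeGr P.deg (n - 1), semifreeDiff P.deg P.D y = x) (n : ℕ) :
    ∃ i, n < P.deg i := by
  by_contra! hbd
  obtain ⟨i, hi⟩ : ∃ i, ∀ j, P.deg j ≤ P.deg i := by
    obtain ⟨_, ⟨i, rfl⟩, hi⟩ := Set.exists_max_image (Set.range P.deg) id
      ((Set.finite_Iic n).subset (by rintro _ ⟨i, rfl⟩; exact hbd i)) (Set.range_nonempty _)
    exact ⟨i, fun j => hi _ ⟨j, rfl⟩⟩
  obtain ⟨a, ha, hda, hab⟩ := hs2
  have hD : semifreeDiff P.deg P.D (op a • P.D i) = 0 := by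
    rw [semifreeDiff_leibniz P.deg P.D _ _ a (P.D_mem i), P.d_D, hda]
    simp
  -- `d (e i * a) = D i * a` is a cocycle on generators of degree below `deg i`, of degree high
  -- enough to be a coboundary there. Hence `e i * a - y` is a cocycle.
  obtain ⟨y, hy, hdy, hysupp⟩ := P.exists_primitive_of_deg_lt hs (P.deg i) (P.deg i + 1 + s)
    (op a • P.D i) (by omega) (act_mem_semifreeGr _ _ _ _ _ (P.D_mem i) ha) hD fun j hj =>
      P.D_lt i j fun h => hj (by rw [Finsupp.smul_apply, h, smul_zero])
  have hx : Finsupp.single i a - y ∈ semifreeGr P.deg (P.deg i + s) := by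
    refine sub_mem (single_mem_semifreeGr (by simpa using ha)) ?_
    rwa [show (P.deg i : ℤ) + 1 + s - 1 = P.deg i + s by ring] at hy
  obtain ⟨z, hz, hdz⟩ := hP _ (by omega) _ hx (by
    rw [map_sub, semifreeDiff_single, hda, hdy]
    simp)
  -- By maximality of `deg i`, the coefficient of `d z` at `e i` is `± d (z i)`; it equals `a`,
  -- which is not a coboundary.
  have hcoeff := semifreeDiff_coeff P.deg P.D (x := z) (i := i) fun l _ => by
    by_contra h
    exact absurd (P.D_lt l i h) (not_lt.2 (hi l))
  have hyi : y i = 0 := by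
    by_contra h
    exact lt_irrefl _ (hysupp i h)
  rw [hdz, Finsupp.sub_apply, Finsupp.single_eq_same, hyi, sub_zero, ← map_unit_smul] at hcoeff
  refine hab _ (unit_smul_mem _ _ ?_) hcoeff.symm
  have := mem_semifreeGr.1 hz i
  rwa [show (P.deg i : ℤ) + s - 1 - P.deg i = s - 1 by ring] at this

end SemifreeData

/-! ### Existence of a semifree resolution of the trivial module -/

/-- Representatives of a basis of a quotient of subspaces. -/
lemma exists_basis_representatives {V : Type*} [AddCommGroup V] [Module k V]
    (Z B : Submodule k V) : ∃ S ⊆ (Z : Set V),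
      (∀ z ∈ Z, ∃ l : V →₀ k, (∀ v, l v ≠ 0 → v ∈ S) ∧
        z - Finsupp.linearCombination k id l ∈ B) ∧
      ∀ l : V →₀ k, (∀ v, l v ≠ 0 → v ∈ S) → Finsupp.linearCombination k id l ∈ B → l = 0 := by
  have hQ (l : V →₀ k) : Finsupp.linearCombination k B.mkQ l =
      B.mkQ (Finsupp.linearCombination k id l) := by
    rw [Finsupp.apply_linearCombination]
    rfl
  -- A maximal subset of `Z` that is independent modulo `B`.
  obtain ⟨S, hSZ, -, hspan, hind⟩ := exists_linearIndepOn_extension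
    (linearIndepOn_empty k B.mkQ) (Set.empty_subset (Z : Set V))
  refine ⟨S, hSZ, fun z hz => ?_, fun l hl hlB => ?_⟩
  · obtain ⟨l, hl, e⟩ := (Finsupp.mem_span_image_iff_linearCombination k).1
      (hspan (Set.mem_image_of_mem _ hz))
    refine ⟨l, fun v hv => hl (Finsupp.mem_support_iff.2 hv), ?_⟩
    rw [hQ] at e
    rw [← Submodule.Quotient.mk_eq_zero, Submodule.Quotient.mk_sub, sub_eq_zero]
    exact e.symm
  · refine linearIndepOn_iff.1 hind l (fun v hv => hl v (Finsupp.mem_support_iff.1 hv)) ?_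
    rw [hQ]
    exact (Submodule.Quotient.mk_eq_zero B).2 hlB

/-- A type of potential generators: in every degree, there is one for every element of the free
module on these generators. -/
lemma exists_universal_generators (A : DGAlgebra k) [Nontrivial A.carrier] :
    ∃ (J : Type u) (deg : J → ℕ) (D : J → J →₀ A.carrier) (gen : ℕ → (J →₀ A.carrier) → J),
      ∀ n v, deg (gen n v) = n ∧ D (gen n v) = v := by
  -- `κ` is infinite and at least as large as `A`, so the free module on `ℕ × κ` embeds in `κ`; `D`
  -- is a left inverse of such an embedding. All stages of the resolution can thus be subsets of one
  -- type.
  let κ : Type u := ℕ × A.carrier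
  have : Infinite κ := inferInstanceAs (Infinite (ℕ × A.carrier))
  have h : Cardinal.mk ((ℕ × κ) →₀ A.carrier) ≤ Cardinal.mk κ := by
    rw [Cardinal.mk_finsupp_of_infinite, max_le_iff]
    constructor
    · rw [Cardinal.mk_prod, Cardinal.lift_uzero, Cardinal.mk_nat, Cardinal.lift_aleph0]
      exact (Cardinal.aleph0_mul_eq (Cardinal.aleph0_le_mk κ)).le
    · exact Cardinal.mk_le_of_injective (f := fun a : A.carrier => ((0, a) : κ))
        fun a b hab => (Prod.ext_iff.1 hab).2
  obtain ⟨φ⟩ := h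
  exact ⟨ℕ × κ, Prod.fst, fun j => Function.invFun φ j.2, fun n v => (n, φ v), fun n v =>
    ⟨rfl, Function.leftInverse_invFun φ.injective v⟩⟩

/-! ### Inductive construction of the resolution -/

section Stages

variable {J : Type u} (deg : J → ℕ) (D : J → J →₀ A.carrier)

/-- A set of generators of degree at most `n`, with a single one of degree `0`, spanning a semifree
module whose cohomology vanishes in degrees `1, …, n + 1`. -/
structure IsStage (j₀ : J) (n : ℕ) (T : Set J) : Prop where
  mem : j₀ ∈ T
  deg_le : ∀ j ∈ T, deg j ≤ n
  eq_of_deg : ∀ j ∈ T, deg j = 0 → j = j₀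
  D_support : ∀ j ∈ T, ∀ i, D j i ≠ 0 → i ∈ T ∧ deg i < deg j
  D_mem : ∀ j ∈ T, D j ∈ semifreeGr deg (deg j + 1)
  d_D : ∀ j ∈ T, semifreeDiff deg D (D j) = 0
  exact : ∀ m : ℤ, 1 ≤ m → m ≤ n + 1 → ∀ x ∈ semifreeGr deg m, (∀ i, x i ≠ 0 → i ∈ T) →
    semifreeDiff deg D x = 0 →
    ∃ y ∈ semifreeGr deg (m - 1), (∀ i, y i ≠ 0 → i ∈ T) ∧ semifreeDiff deg D y = x

variable {deg D} (hA : A.IsSimplyConnectedOfFiniteType)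
include hA

/-- The free module on one generator of degree `0` is `A` itself, so exactness in degree `1` is `H¹
A = 0`. -/
lemma isStage_zero {j₀ : J} (hdeg : deg j₀ = 0) (hD : D j₀ = 0) : IsStage deg D j₀ 0 {j₀} where
  mem := rfl
  deg_le := by rintro _ rfl; exact hdeg.le
  eq_of_deg := fun _ h _ => h
  D_support := by rintro _ rfl i hi; simp [hD] at hi
  D_mem := by rintro _ rfl; rw [hD]; exact zero_mem _
  d_D := by rintro _ rfl; rw [hD, map_zero]
  exact := by
    intro m h1 h2 x hx hsupp hdx
    obtain rfl : m = 1 := by push_cast at h2; omega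
    have hDl (l : J) (hl : l ∈ ({j₀} : Set J)) (i : J) : D l i = 0 := by
      obtain rfl := hl
      rw [hD, Finsupp.zero_apply]
    obtain ⟨u, hu, husupp, hdu⟩ := exists_kill_coeff (n := 1) (x := x) deg D (N := {j₀})
      (fun l hl i _ => hDl l hl i) (by
        intro i hi
        rw [Set.mem_singleton_iff.1 hi]
        have hx' := mem_semifreeGr.1 hx j₀
        rw [hdeg] at hx' ⊢
        exact DGAlgebra.exists_primitive_of_subsingleton hA.H_one hx'
          (d_coeff_eq_zero deg D (fun l hl => hDl l (hsupp l hl) _) hdx))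
    refine ⟨u, hu, fun i hi => (husupp i hi).1, Finsupp.ext fun i => ?_⟩
    by_cases hi : i = j₀
    · exact hdu i hi
    · rw [not_not.1 fun h => hi (hsupp i h)]
      by_contra h
      exact hi (semifreeDiff_support deg D (T := {j₀}) (fun j hj i h => absurd (hDl j hj i) h)
        (fun i hi => (husupp i hi).1) i h)

/-- Adjoin generators of degree `n + 1` whose differentials represent a basis of the cohomology in
degree `n + 2` of the span of `T`. They occur in no differential of a generator, so their
coefficients in a cocycle are cocycles of `A`. For a cocycle of degree at most `n` these
coefficients have negative degree and vanish. In degree `n + 1` they are scalars, which vanish by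
independence of the basis. In degree `n + 2` they have degree `1`, so they are coboundaries and can
be removed. -/
lemma IsStage.exists_succ (ε : A.Augmentation) {gen : ℕ → (J →₀ A.carrier) → J}
    (hgen : ∀ n v, deg (gen n v) = n ∧ D (gen n v) = v) {j₀ : J} {n : ℕ} {T : Set J}
    (hT : IsStage deg D j₀ n T) : ∃ T', T ⊆ T' ∧ IsStage deg D j₀ (n + 1) T' := by
  classical
  let supp : Submodule k (J →₀ A.carrier) := Finsupp.supported A.carrier k T
  have mem_supp {x : J →₀ A.carrier} : x ∈ supp ↔ ∀ i, x i ≠ 0 → i ∈ T :=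
    ⟨fun h i hi => h (Finsupp.mem_support_iff.2 hi),
      fun h i hi => h i (Finsupp.mem_support_iff.1 hi)⟩
  obtain ⟨S, hSZ, hspan, hind⟩ := exists_basis_representatives
    (semifreeGr deg (n + 2) ⊓ supp ⊓ LinearMap.ker (semifreeDiff deg D))
    ((semifreeGr deg (n + 1) ⊓ supp).map (semifreeDiff deg D))
  have hinj : Function.Injective (gen (n + 1)) := fun v w h => by
    rw [← (hgen (n + 1) v).2, h, (hgen (n + 1) w).2]
  let N : Set J := gen (n + 1) '' S
  have hNdeg (i : J) (hi : i ∈ N) : deg i = n + 1 := by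
    obtain ⟨v, -, rfl⟩ := hi
    exact (hgen _ v).1
  have hNT (i : J) (hi : i ∈ N) : i ∉ T := fun h => by
    have := hT.deg_le i h
    rw [hNdeg i hi] at this
    omega
  have hDsupp (j : J) (hj : j ∈ T ∪ N) (i : J) (hi : D j i ≠ 0) : i ∈ T ∧ deg i < deg j := by
    rcases hj with hj | ⟨v, hv, rfl⟩
    · exact hT.D_support j hj i hi
    · rw [(hgen _ v).2] at hi
      have hiT := mem_supp.1 (hSZ hv).1.2 i hi
      refine ⟨hiT, ?_⟩
      rw [(hgen _ v).1]
      exact Nat.lt_succ_of_le (hT.deg_le i hiT)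
  have hDmem (j : J) (hj : j ∈ T ∪ N) : D j ∈ semifreeGr deg (deg j + 1) := by
    rcases hj with hj | ⟨v, hv, rfl⟩
    · exact hT.D_mem j hj
    · rw [(hgen _ v).1, (hgen _ v).2]
      have := (hSZ hv).1.1
      rwa [show (n : ℤ) + 2 = (n + 1 : ℕ) + 1 by push_cast; ring] at this
  have hdD (j : J) (hj : j ∈ T ∪ N) : semifreeDiff deg D (D j) = 0 := by
    rcases hj with hj | ⟨v, hv, rfl⟩
    · exact hT.d_D j hj
    · rw [(hgen _ v).2]
      exact (hSZ hv).2
  have hDN (l : J) (hl : l ∈ T ∪ N) (i : J) (hi : i ∈ N) : D l i = 0 :=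
    not_not.1 fun h => hNT i hi (hDsupp l hl i h).1
  let E : ((J →₀ A.carrier) →₀ k) →ₗ[k] (J →₀ A.carrier) :=
    Finsupp.linearCombination k fun v => Finsupp.single (gen (n + 1) v) 1
  have hdE (l : (J →₀ A.carrier) →₀ k) :
      semifreeDiff deg D (E l) = Finsupp.linearCombination k id l := by
    have h : (semifreeDiff deg D ∘ fun v => Finsupp.single (gen (n + 1) v) (1 : A.carrier)) = id :=
      funext fun v => (semifreeDiff_single_one deg D _).trans (hgen _ v).2
    rw [Finsupp.apply_linearCombination, h]
  have hEmem (l : (J →₀ A.carrier) →₀ k) : E l ∈ semifreeGr deg (n + 1) := by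
    refine Submodule.sum_mem _ fun v _ => Submodule.smul_mem _ _ ?_
    have := single_one_mem_semifreeGr (A := A) deg (gen (n + 1) v)
    rw [(hgen _ v).1] at this
    exact_mod_cast this
  have hEcoeff (l : (J →₀ A.carrier) →₀ k) (v : J →₀ A.carrier) :
      E l (gen (n + 1) v) = l v • 1 := by
    induction l using Finsupp.induction_linear with
    | zero => simp
    | add x y hx hy => rw [map_add, Finsupp.add_apply, hx, hy, Finsupp.add_apply, add_smul]
    | single w c =>
      simp only [E, Finsupp.linearCombination_single, Finsupp.smul_apply, Finsupp.single_apply,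
        hinj.eq_iff]
      split_ifs <;> simp
  have hEsupp (l : (J →₀ A.carrier) →₀ k) (hl : ∀ v, l v ≠ 0 → v ∈ S) (i : J) (hi : E l i ≠ 0) :
      i ∈ N := by
    by_contra h
    refine hi ?_
    simp only [E, Finsupp.linearCombination_apply, Finsupp.sum, Finsupp.finsetSum_apply]
    refine Finset.sum_eq_zero fun v hv => ?_
    have : i ≠ gen (n + 1) v := by
      rintro rfl
      exact h ⟨v, hl v (Finsupp.mem_support_iff.1 hv), rfl⟩
    rw [Finsupp.smul_apply, Finsupp.single_eq_of_ne this, smul_zero]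
  refine ⟨T ∪ N, Set.subset_union_left, Or.inl hT.mem, ?_, ?_, fun j hj i hi =>
    ⟨Or.inl (hDsupp j hj i hi).1, (hDsupp j hj i hi).2⟩, hDmem, hdD, ?_⟩
  · rintro j (hj | hj)
    · exact (hT.deg_le j hj).trans (Nat.le_succ n)
    · exact (hNdeg j hj).le
  · rintro j (hj | hj) h
    · exact hT.eq_of_deg j hj h
    · rw [hNdeg j hj] at h
      omega
  · intro m h1 h2 x hx hsupp hdx
    have hcocycle (i : J) (hi : i ∈ N) : A.d (x i) = 0 :=
      d_coeff_eq_zero deg D (fun l hl => hDN l (hsupp l hl) i hi) hdx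
    have hxmem (i : J) (hi : i ∈ N) : x i ∈ A.gr (m - (n + 1)) := by
      have := mem_semifreeGr.1 hx i
      rw [hNdeg i hi] at this
      exact_mod_cast this
    rcases (show m ≤ n + 1 ∨ m = n + 2 by push_cast at h2; omega) with hm | rfl
    · have hxT (i : J) (hi : x i ≠ 0) : i ∈ T := by
        refine (hsupp i hi).resolve_right fun hiN => ?_
        rcases hm.lt_or_eq with hm | rfl
        · exact hi (hA.eq_zero_of_neg (by omega) (hxmem i hiN))
        -- `l` collects the scalar coefficients of `x` at the new generators, so `E l` and `x` agree
        -- there.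
        · let l : (J →₀ A.carrier) →₀ k :=
            ((x.comapDomain (gen (n + 1)) hinj.injOn).mapRange ε.toAlgHom (map_zero _)).filter
              (· ∈ S)
          have hl (v : J →₀ A.carrier) (hv : v ∈ S) : l v = ε.toAlgHom (x (gen (n + 1) v)) :=
            Finsupp.filter_apply_pos (· ∈ S) _ hv
          have hlS (v : J →₀ A.carrier) (hv : l v ≠ 0) : v ∈ S := by
            by_contra h
            exact hv (Finsupp.filter_apply_neg (· ∈ S) _ h)
          have hxE (v : J →₀ A.carrier) (hv : v ∈ S) :
              x (gen (n + 1) v) = E l (gen (n + 1) v) := by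
            rw [hEcoeff, hl v hv]
            have hvN : gen (n + 1) v ∈ N := ⟨v, hv, rfl⟩
            have := hxmem _ hvN
            rw [sub_self] at this
            exact hA.eq_algebraMap ε this (hcocycle _ hvN)
          have hsub : E l - x ∈ supp := mem_supp.2 fun j hj => by
            by_contra hjT
            refine hj ?_
            rw [Finsupp.sub_apply]
            by_cases hjN : j ∈ N
            · obtain ⟨v, hv, rfl⟩ := hjN
              rw [hxE v hv, sub_self]
            · rw [not_not.1 fun h => hjN (hEsupp l hlS j h),
                not_not.1 fun h => (hsupp j h).elim hjT hjN, sub_self]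
          -- `E l - x` is supported on `T` and its differential is `Σ l v • v`, so this combination
          -- of basis representatives is a coboundary on `T`.
          have hl0 : l = 0 := by
            refine hind l hlS ⟨E l - x, ⟨sub_mem (hEmem l) hx, hsub⟩, ?_⟩
            rw [map_sub, hdx, hdE, sub_zero]
          obtain ⟨v, hv, rfl⟩ := hiN
          rw [hxE v hv, hl0, map_zero] at hi
          exact hi rfl
      obtain ⟨y, hy, hysupp, hdy⟩ := hT.exact m h1 hm x hx hxT hdx
      exact ⟨y, hy, fun i hi => Or.inl (hysupp i hi), hdy⟩
    · obtain ⟨u, hu, husupp, hdu⟩ := exists_kill_coeff (n := n + 2) (x := x) deg D (N := N)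
        (fun l hl i hi => hDN l (Or.inr hl) i hi) (fun i hi => by
          have := hxmem i hi
          rw [show (n : ℤ) + 2 - (n + 1) = 1 by ring] at this
          obtain ⟨b, hb, e⟩ :=
            DGAlgebra.exists_primitive_of_subsingleton hA.H_one this (hcocycle i hi)
          refine ⟨b, ?_, e⟩
          rw [hNdeg i hi]
          push_cast
          rwa [show (n : ℤ) + 2 - 1 - (n + 1) = 1 - 1 by ring])
      have huT (i : J) (hi : u i ≠ 0) : i ∈ T ∪ N := Or.inr (husupp i hi).1
      have hdumem : semifreeDiff deg D u ∈ semifreeGr deg (n + 2) := by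
        have := semifreeDiff_mem hu fun i hi => hDmem i (huT i hi)
        rwa [sub_add_cancel] at this
      have hduT := semifreeDiff_support deg D (T := T ∪ N)
        (fun j hj i hi => Or.inl (hDsupp j hj i hi).1) huT
      -- After removal of `d u` the cocycle lives on `T`. Modulo coboundaries of `T` it is a
      -- combination of basis representatives, and that combination is the differential of `E l`.
      obtain ⟨l, hlS, y, ⟨hy, hyT⟩, hdy⟩ := hspan (x - semifreeDiff deg D u)
        ⟨⟨sub_mem hx hdumem, mem_supp.2 fun i hi => by
          by_contra hiT
          refine hi ?_
          rw [Finsupp.sub_apply]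
          by_cases hiN : i ∈ N
          · rw [hdu i hiN, sub_self]
          · rw [not_not.1 fun h => (hduT i h).elim hiT hiN,
              not_not.1 fun h => (hsupp i h).elim hiT hiN, sub_self]⟩, by
          change semifreeDiff deg D _ = 0
          rw [map_sub, hdx, semifreeDiff_semifreeDiff (fun i hi => hDmem i (huT i hi))
            (fun i hi => hdD i (huT i hi)), sub_zero]⟩
      refine ⟨u + E l + y, ?_, fun i hi => ?_, ?_⟩
      · rw [show (n : ℤ) + 2 - 1 = n + 1 by ring] at hu ⊢
        exact add_mem (add_mem hu (hEmem l)) hy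
      · by_contra h
        refine hi ?_
        rw [Finsupp.add_apply, Finsupp.add_apply, not_not.1 fun h' => h (huT i h'),
          not_not.1 fun h' => h (Or.inr (hEsupp l hlS i h')),
          not_not.1 fun h' => h (Or.inl (mem_supp.1 hyT i h')), add_zero, add_zero]
      · rw [map_add, map_add, hdy, hdE]
        abel

end Stages

/-- There are semifree modules with a single generator of degree `0` whose cohomology vanishes in
positive degrees. -/
lemma exists_semifree_resolution (hA : A.IsSimplyConnectedOfFiniteType) (ε : A.Augmentation) :
    ∃ (P : SemifreeData A) (i₀ : P.I), P.deg i₀ = 0 ∧ (∀ i, P.deg i = 0 → i = i₀) ∧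
      ∀ n : ℤ, 1 ≤ n → ∀ x ∈ semifreeGr P.deg n, semifreeDiff P.deg P.D x = 0 →
        ∃ y ∈ semifreeGr P.deg (n - 1), semifreeDiff P.deg P.D y = x := by
  have : Nontrivial A.carrier := ε.toAlgHom.toRingHom.domain_nontrivial
  obtain ⟨J, deg, D, gen, hgen⟩ := exists_universal_generators A
  have hsucc (n : ℕ) (T : Set J) : ∃ T', IsStage deg D (gen 0 0) n T →
      T ⊆ T' ∧ IsStage deg D (gen 0 0) (n + 1) T' := by
    by_cases hT : IsStage deg D (gen 0 0) n T
    · obtain ⟨T', h⟩ := hT.exists_succ hA ε hgen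
      exact ⟨T', fun _ => h⟩
    · exact ⟨T, fun h => absurd h hT⟩
  choose next hnext using hsucc
  let T : ℕ → Set J := fun n => Nat.rec {gen 0 0} next n
  have hT (n : ℕ) : IsStage deg D (gen 0 0) n (T n) := by
    induction n with
    | zero => exact isStage_zero hA (hgen 0 0).1 (hgen 0 0).2
    | succ n ih => exact (hnext n _ ih).2
  have hmono : Monotone T := monotone_nat_of_le_succ fun n => (hnext n _ (hT n)).1
  let U : Set J := ⋃ n, T n
  have hU {j : J} (hj : j ∈ U) : ∃ n, j ∈ T n := Set.mem_iUnion.1 hj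
  -- A finite support lies in a single stage, which may be taken late enough for its exactness range
  -- to contain a given degree.
  have hfin (x : J →₀ A.carrier) (hx : ∀ i, x i ≠ 0 → i ∈ U) (m : ℕ) :
      ∃ n, m ≤ n ∧ ∀ i, x i ≠ 0 → i ∈ T n := by
    choose! f hf using fun i hi => hU (hx i hi)
    refine ⟨max m (x.support.sup f), le_max_left _ _, fun i hi => hmono ?_ (hf i hi)⟩
    exact (Finset.le_sup (Finsupp.mem_support_iff.2 hi)).trans (le_max_right _ _)
  classical
  -- `res` and `ext` identify vectors indexed by `U` with vectors supported in `U`; all properties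
  -- are transferred through them.
  let res (x : J →₀ A.carrier) : U →₀ A.carrier := x.subtypeDomain (· ∈ U)
  let ext (x : U →₀ A.carrier) : J →₀ A.carrier := Finsupp.mapDomain Subtype.val x
  have ext_inj : Function.Injective ext := Finsupp.mapDomain_injective Subtype.val_injective
  have ext_apply (x : U →₀ A.carrier) (i : U) : ext x i = x i :=
    Finsupp.mapDomain_apply Subtype.val_injective x i
  have ext_support (x : U →₀ A.carrier) (i : J) (hi : ext x i ≠ 0) : i ∈ U := by
    by_contra h
    exact hi (Finsupp.mapDomain_of_notMem_range _ _ (by simpa using h))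
  have ext_res {x : J →₀ A.carrier} (hx : ∀ i, x i ≠ 0 → i ∈ U) : ext (res x) = x := by
    ext i
    by_cases hi : i ∈ U
    · exact ext_apply _ ⟨i, hi⟩
    · rw [not_not.1 fun h => hi (hx i h), not_not.1 fun h => hi (ext_support _ i h)]
  let degU (i : U) : ℕ := deg i
  let DU (i : U) : U →₀ A.carrier := res (D i)
  have hDU (i : U) : ext (DU i) = D i := by
    obtain ⟨n, hn⟩ := hU i.2
    exact ext_res fun l hl => Set.mem_iUnion.2 ⟨n, ((hT n).D_support i hn l hl).1⟩
  have ext_d (x : U →₀ A.carrier) :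
      ext (semifreeDiff degU DU x) = semifreeDiff deg D (ext x) := by
    have h1 := rightLift_comp_mapDomain (k := k) (Subtype.val : U → J) DU x
    have h2 := rightLift_mapDomain (k := k) (Subtype.val : U → J) D x
    have h3 : (fun i : U => D i) = fun i => Finsupp.mapDomain Subtype.val (DU i) :=
      funext fun i => (hDU i).symm
    simp only [ext]
    rw [semifreeDiff_eq, semifreeDiff_eq, Finsupp.mapDomain_add, ← h1, h2, h3, coeffDiff_mapDomain]
  have ext_mem {x : U →₀ A.carrier} {n : ℤ} (hx : x ∈ semifreeGr degU n) :
      ext x ∈ semifreeGr deg n := mapDomain_mem_semifreeGr Subtype.val deg hx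
  have res_mem {x : J →₀ A.carrier} {n : ℤ} (hx : x ∈ semifreeGr deg n) :
      res x ∈ semifreeGr degU n := mem_semifreeGr.2 fun i => mem_semifreeGr.1 hx i
  refine ⟨⟨U, degU, DU, fun i => ?_, fun i j hij => ?_, fun i => ?_⟩,
    ⟨gen 0 0, Set.mem_iUnion.2 ⟨0, rfl⟩⟩, (hgen 0 0).1, fun i hi => ?_, fun n hn x hx hdx => ?_⟩
  · obtain ⟨n, h⟩ := hU i.2
    exact res_mem ((hT n).D_mem i h)
  · obtain ⟨n, h⟩ := hU i.2
    exact ((hT n).D_support i h j hij).2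
  · obtain ⟨n, h⟩ := hU i.2
    apply ext_inj
    rw [ext_d, hDU, (hT n).d_D i h]
    exact Finsupp.mapDomain_zero.symm
  · obtain ⟨n, h⟩ := hU i.2
    exact Subtype.ext ((hT n).eq_of_deg i h hi)
  · obtain ⟨N, hN, hxN⟩ := hfin (ext x) (ext_support x) n.toNat
    obtain ⟨y, hy, hyN, hdy⟩ := (hT N).exact n hn (by omega) (ext x) (ext_mem hx) hxN (by
      rw [← ext_d]
      exact (congrArg ext hdx).trans Finsupp.mapDomain_zero)
    refine ⟨res y, res_mem hy, ext_inj ?_⟩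
    exact (ext_d _).trans
      ((congrArg _ (ext_res fun i hi => Set.mem_iUnion.2 ⟨N, hyN i hi⟩)).trans hdy)

/-! ### The resolution of the trivial module -/

lemma bijective_cohomologyMap {X Y : DGModule A} (w : X ⟶ Y) (n : ℤ)
    (hinj : ∀ x ∈ X.gr n, X.d x = 0 → (∃ y ∈ Y.gr (n - 1), Y.d y = w.toLinearMap x) →
      ∃ x' ∈ X.gr (n - 1), X.d x' = x)
    (hsurj : ∀ y ∈ Y.gr n, Y.d y = 0 → ∃ x ∈ X.gr n, X.d x = 0 ∧ w.toLinearMap x = y) :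
    Function.Bijective (DGModule.cohomologyMap w n) := by
  constructor
  · rw [injective_iff_map_eq_zero]
    intro x hx
    obtain ⟨⟨x, hx1, hx2⟩, rfl⟩ := Submodule.Quotient.mk_surjective _ x
    exact (Submodule.Quotient.mk_eq_zero _).2
      (hinj x hx1 hx2 ((Submodule.Quotient.mk_eq_zero _).1 hx))
  · intro y
    obtain ⟨⟨y, hy1, hy2⟩, rfl⟩ := Submodule.Quotient.mk_surjective _ y
    obtain ⟨x, hx1, hx2, rfl⟩ := hsurj y hy1 hy2
    exact ⟨Submodule.Quotient.mk ⟨x, hx1, hx2⟩, rfl⟩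

namespace SemifreeData

variable (P : SemifreeData A) (ε : A.Augmentation) {i₀ : P.I} (hi₀ : P.deg i₀ = 0)

/-- The morphism to the trivial module sending a generator of degree `0` to `1` and the others
to `0`. -/
def toTrivial : P.toDGModule ⟶ ε.trivialModule where
  toLinearMap := ε.toAlgHom.toLinearMap ∘ₗ Finsupp.lapply i₀
  map_act x a := (map_mul ε.toAlgHom _ _).trans (mul_comm _ _)
  map_mem n x hx := by
    change ε.toAlgHom ((x : P.I →₀ A.carrier) i₀) ∈ trivialGrading k n
    by_cases hn : n = 0
    · simp [trivialGrading, hn]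
    · have := mem_semifreeGr.1 hx i₀
      rw [hi₀, Nat.cast_zero, sub_zero] at this
      rw [ε.map_of_ne_zero n _ hn this]
      exact zero_mem _
  map_d x := P.augmentation_d ε x i₀

/-- In negative degrees `P` is zero and in positive degrees it has no cohomology. In degree `0` only
the coefficient at `i₀` can be nonzero, and it is a scalar when the element is a cocycle. -/
lemma bijective_cohomologyMap_toTrivial (hA : A.IsSimplyConnectedOfFiniteType)
    (hdeg : ∀ i, P.deg i = 0 → i = i₀)
    (hP : ∀ n : ℤ, 1 ≤ n → ∀ x ∈ semifreeGr P.deg n, semifreeDiff P.deg P.D x = 0 →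
      ∃ y ∈ semifreeGr P.deg (n - 1), semifreeDiff P.deg P.D y = x) (n : ℤ) :
    Function.Bijective (DGModule.cohomologyMap (P.toTrivial ε hi₀) n) := by
  refine bijective_cohomologyMap _ n (fun x hx hdx hw => ?_) fun y hy _ => ?_
  · rcases lt_trichotomy n 0 with hn | rfl | hn
    · have : x = 0 := Finsupp.ext fun i =>
        hA.eq_zero_of_neg (by omega) (mem_semifreeGr.1 hx i)
      exact ⟨0, zero_mem _, by rw [this, map_zero]⟩
    · obtain ⟨y, -, hy⟩ := hw
      have hε : ε.toAlgHom ((x : P.I →₀ A.carrier) i₀) = 0 := hy.symm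
      have hne (i : P.I) (hi : i ≠ i₀) : (x : P.I →₀ A.carrier) i = 0 := by
        have : P.deg i ≠ 0 := fun h => hi (hdeg i h)
        exact hA.eq_zero_of_neg (by omega) (mem_semifreeGr.1 hx i)
      have h0 : (x : P.I →₀ A.carrier) i₀ = 0 := by
        have hmem := mem_semifreeGr.1 hx i₀
        rw [hi₀, Nat.cast_zero, sub_zero] at hmem
        rw [hA.eq_algebraMap ε hmem (d_coeff_eq_zero P.deg P.D (fun l hl => ?_) hdx), hε, zero_smul]
        obtain rfl := not_not.1 fun h => hl (hne l h)
        by_contra h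
        exact lt_irrefl _ (P.D_lt l l h)
      have : x = 0 := Finsupp.ext fun i => by
        by_cases hi : i = i₀
        · rw [hi]; exact h0
        · exact hne i hi
      exact ⟨0, zero_mem _, by rw [this, map_zero]⟩
    · exact hP n (by omega) x hx hdx
  · by_cases hn : n = 0
    · subst hn
      obtain ⟨c, hc⟩ : ∃ c : k, c = y := ⟨y, rfl⟩
      have hD : P.D i₀ = 0 := Finsupp.ext fun j => by
        by_contra h
        have := P.D_lt i₀ j h
        omega
      refine ⟨Finsupp.single i₀ (c • 1), single_mem_semifreeGr ?_, ?_, ?_⟩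
      · rw [hi₀]
        exact Submodule.smul_mem _ _ A.one_mem
      · refine (semifreeDiff_single P.deg P.D i₀ _).trans ?_
        rw [hD, map_smul, A.d_one]
        simp
      · change ε.toAlgHom (Finsupp.single i₀ (c • (1 : A.carrier)) i₀) = y
        rw [Finsupp.single_eq_same, map_smul, map_one, smul_eq_mul, mul_one, hc]
    · have hy0 : y = 0 := trivialGrading_eq_zero (k := k) hn hy
      exact ⟨0, zero_mem _, map_zero _, (map_zero _).trans hy0.symm⟩

end SemifreeData

lemma isIso_toDerivedCat_map {X Y : DGModule A} (w : X ⟶ Y)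
    (hw : ∀ n, Function.Bijective (DGModule.cohomologyMap w n)) :
    IsIso ((toDerivedCat A).map w) :=
  (quasiIso A).Q_inverts _ ((quasiIso_functor_map_iff w).2 hw)

end DG

end

/-! ### Non-compactness of the trivial module -/

theorem corollary3p12 (k : Type u) [Field k] (A : DG.DGAlgebra k) (ε : A.Augmentation)
    (hA : A.IsSimplyConnectedOfFiniteType) (hdim : 2 ≤ Module.finrank k A.TotalH) :
    ¬ DG.IsCompactObject.{u} ((DG.toDerivedCat A).obj ε.trivialModule) := by
  intro H
  obtain ⟨P, i₀, hi₀, hdeg, hP⟩ := DG.exists_semifree_resolution hA ε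
  obtain ⟨s, hs1, hs2, hs⟩ := hA.exists_top_degree hdim
  have := DG.isIso_toDerivedCat_map _ (P.bijective_cohomologyMap_toTrivial ε hi₀ hA hdeg hP)
  have : Nonempty P.I := ⟨i₀⟩
  exact P.not_isCompactObject ε (P.exists_deg_gt hs1 hs2 hs hP)
    (H.of_iso (asIso ((DG.toDerivedCat A).map (P.toTrivial ε hi₀))).symm)
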